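/- Let $n\ge 1$, let $\Omega\subset\mathbb R^n$ be an arbitrary bounded domain (a non-empty, bounded, connected open set, with no regularity assumed on its boundary), and let $c,\varepsilon,\nu>0$. Let $H^1_0(\Omega)$ be the closure of $C_c^\infty(\Omega)$ in the $H^1$ norm and let $H^{-1}(\Omega)$ be its topological dual; all functions are real-valued. Let $f\in L^2([0,+\infty[;L^2(\Omega))$, $u_0\in H^1_0(\Omega)$ and $u_1\in L^2(\Omega)$. Then the problem $$\partial_t^2u-c^2\Delta u-\varepsilon\nu\,\Delta\partial_tu=f\ \text{ on } ]0,+\infty[\times\Omega,\qquad u|_{\partial\Omega}=0,\qquad u(0)=u_0,\quad \partial_tu(0)=u_1$$ has a unique weak solution in the following sense: there exists a unique $u\in L^2([0,+\infty[;H^1_0(\Omega))$ with weak time derivatives $\partial_tu\in L^2([0,+\infty[;H^1_0(\Omega))$ and $\partial_t^2u\in L^2([0,+\infty[;H^{-1}(\Omega))$ such that $u(0)=u_0$, $\partial_tu(0)=u_1$ and, for all $v\in L^2([0,+\infty[;H^1_0(\Omega))$, $$\int_0^{+\infty}\Big(\langle\partial_t^2u,v\rangle_{(H^{-1}(\Omega),H^1_0(\Omega))}+c^2(\nabla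 u,\nabla v)_{L^2(\Omega)}+\varepsilon\nu(\nabla\partial_tu,\nabla v)_{L^2(\Omega)}\Big)\,ds=\int_0^{+\infty}(f,v)_{L^2(\Omega)}\,ds .$$ Here $L^2(\Omega)$ is embedded in $H^{-1}(\Omega)$ by the $L^2$ inner product, and the initial conditions refer to the representatives of $u$ in $C([0,+\infty[;H^1_0(\Omega))$ and of $\partial_tu$ in $C([0,+\infty[;L^2(\Omega))$. -/

import Mathlib

open MeasureTheory Set
open scoped ContDiff

noncomputable section

namespace DampedWave

/-- Real Euclidean space `ℝⁿ`. -/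
abbrev E (n : ℕ) : Type := EuclideanSpace ℝ (Fin n)

/-- `L²(Ω)`, real-valued. -/
abbrev L2 {n : ℕ} (Ω : Set (E n)) : Type := Lp ℝ 2 (volume.restrict Ω)

/-- `L²(Ω; ℝⁿ)`, the space of square integrable vector fields. -/
abbrev L2vec {n : ℕ} (Ω : Set (E n)) : Type := Lp (E n) 2 (volume.restrict Ω)

/-- The Hilbert space `L²(Ω) × L²(Ω; ℝⁿ)` with `‖(u, G)‖² = ‖u‖² + ‖G‖²`. On pairs `(u, ∇u)` this
is the `H¹` norm. -/
abbrev L2Pair {n : ℕ} (Ω : Set (E n)) : Type := WithLp 2 (L2 Ω × L2vec Ω)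

/-- `φ ∈ C_c^∞(U)`. -/
structure IsTest {F : Type*} [NormedAddCommGroup F] [NormedSpace ℝ F] (U : Set F) (φ : F → ℝ) :
    Prop where
  smooth : ContDiff ℝ ∞ φ
  compact : HasCompactSupport φ
  supp : tsupport φ ⊆ U

/-- `G` is the weak gradient of `u` on `Ω`: `∫_Ω u ∇φ = - ∫_Ω φ G` for all `φ ∈ C_c^∞(Ω)`. -/
def IsWeakGradient {n : ℕ} (Ω : Set (E n)) (u : E n → ℝ) (G : E n → E n) : Prop :=
  ∀ φ : E n → ℝ, IsTest Ω φ → ∫ x in Ω, u x • gradient φ x = -∫ x in Ω, φ x • G x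

theorem IsTest.zero {F : Type*} [NormedAddCommGroup F] [NormedSpace ℝ F] (U : Set F) :
    IsTest U (fun _ => (0 : ℝ)) := by
  refine ⟨contDiff_const, HasCompactSupport.zero, ?_⟩
  have h : tsupport (fun _ : F => (0 : ℝ)) = ∅ := tsupport_eq_empty_iff.2 rfl
  simp [h]

theorem IsTest.add {F : Type*} [NormedAddCommGroup F] [NormedSpace ℝ F] {U : Set F}
    {φ ψ : F → ℝ} (hφ : IsTest U φ) (hψ : IsTest U ψ) : IsTest U (fun x => φ x + ψ x) :=
  ⟨hφ.smooth.add hψ.smooth, hφ.compact.add hψ.compact,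
    (tsupport_add φ ψ).trans (union_subset hφ.supp hψ.supp)⟩

theorem IsTest.smul {F : Type*} [NormedAddCommGroup F] [NormedSpace ℝ F] {U : Set F}
    {φ : F → ℝ} (c : ℝ) (hφ : IsTest U φ) : IsTest U (fun x => c * φ x) :=
  ⟨contDiff_const.mul hφ.smooth, hφ.compact.mul_left,
    (tsupport_mul_subset_right (f := fun _ => c)).trans hφ.supp⟩

theorem IsTest.continuous_gradient {n : ℕ} {U : Set (E n)} {φ : E n → ℝ} (hφ : IsTest U φ) :
    Continuous (gradient φ) :=
  (InnerProductSpace.toDual ℝ (E n)).symm.continuous.comp (hφ.smooth.continuous_fderiv (by simp))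

theorem IsTest.compact_gradient {n : ℕ} {U : Set (E n)} {φ : E n → ℝ} (hφ : IsTest U φ) :
    HasCompactSupport (gradient φ) :=
  (hφ.compact.fderiv (𝕜 := ℝ)).comp_left (map_zero _)

theorem IsTest.gradient_add {n : ℕ} {U : Set (E n)} {φ ψ : E n → ℝ} (hφ : IsTest U φ)
    (hψ : IsTest U ψ) (x : E n) :
    gradient (fun x => φ x + ψ x) x = gradient φ x + gradient ψ x := by
  have h1 := (hφ.smooth.differentiable (by simp)) x
  have h2 := (hψ.smooth.differentiable (by simp)) x
  simp only [gradient]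
  rw [fderiv_fun_add h1 h2, map_add]

theorem IsTest.gradient_smul {n : ℕ} {U : Set (E n)} {φ : E n → ℝ} (c : ℝ) (hφ : IsTest U φ)
    (x : E n) : gradient (fun x => c * φ x) x = c • gradient φ x := by
  have h1 := (hφ.smooth.differentiable (by simp)) x
  simp only [gradient]
  rw [fderiv_const_mul h1, map_smul]

/-- The pairs `(φ, ∇φ)` with `φ ∈ C_c^∞(Ω)`. -/
def testPairs {n : ℕ} (Ω : Set (E n)) : Submodule ℝ (L2Pair Ω) where
  carrier := {p | ∃ φ : E n → ℝ, IsTest Ω φ ∧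
    p.fst =ᵐ[volume.restrict Ω] φ ∧ p.snd =ᵐ[volume.restrict Ω] gradient φ}
  zero_mem' := by
    refine ⟨fun _ => 0, IsTest.zero Ω, Lp.coeFn_zero _ _ _, ?_⟩
    filter_upwards [Lp.coeFn_zero (E n) 2 (volume.restrict Ω)] with x hx
    simpa [gradient] using hx
  add_mem' := by
    rintro p q ⟨φ, hφ, h1, h2⟩ ⟨ψ, hψ, h3, h4⟩
    refine ⟨_, hφ.add hψ, ?_, ?_⟩
    · filter_upwards [Lp.coeFn_add p.fst q.fst, h1, h3] with x hx h1 h3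
      simpa [h1, h3] using hx
    · filter_upwards [Lp.coeFn_add p.snd q.snd, h2, h4] with x hx h2 h4
      rw [hφ.gradient_add hψ, ← h2, ← h4]
      simpa using hx
  smul_mem' := by
    rintro c p ⟨φ, hφ, h1, h2⟩
    refine ⟨_, hφ.smul c, ?_, ?_⟩
    · filter_upwards [Lp.coeFn_smul c p.fst, h1] with x hx h1
      simpa [h1] using hx
    · filter_upwards [Lp.coeFn_smul c p.snd, h2] with x hx h2
      rw [hφ.gradient_smul c, ← h2]
      simpa using hx

/-- `H¹₀(Ω)`, the closure of `C_c^∞(Ω)` for the `H¹` norm. An element is stored as the pair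
`(u, ∇u)` of a function and its weak gradient. -/
def H10 {n : ℕ} (Ω : Set (E n)) : Submodule ℝ (L2Pair Ω) := (testPairs Ω).topologicalClosure

/-- The inclusion `H¹₀(Ω) → L²(Ω)`. -/
def toL2 {n : ℕ} (Ω : Set (E n)) : H10 Ω →L[ℝ] L2 Ω :=
  (WithLp.fstL 2 ℝ (L2 Ω) (L2vec Ω)).comp (H10 Ω).subtypeL

/-- The gradient `∇ : H¹₀(Ω) → L²(Ω; ℝⁿ)`. -/
def grad {n : ℕ} (Ω : Set (E n)) : H10 Ω →L[ℝ] L2vec Ω :=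
  (WithLp.sndL 2 ℝ (L2 Ω) (L2vec Ω)).comp (H10 Ω).subtypeL

/-- The second component of an element of `H¹₀(Ω)` is the weak gradient of the first one. -/
theorem isWeakGradient_grad {n : ℕ} (Ω : Set (E n)) (u : H10 Ω) :
    IsWeakGradient Ω (toL2 Ω u) (grad Ω u) := by
  intro φ hφ
  have hcg : Continuous (gradient φ) := hφ.continuous_gradient
  have hsg : HasCompactSupport (gradient φ) := hφ.compact_gradient
  have hmg : MemLp (gradient φ) 2 (volume.restrict Ω) := hcg.memLp_of_hasCompactSupport hsg
  have hmφ : MemLp φ 2 (volume.restrict Ω) :=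
    hφ.smooth.continuous.memLp_of_hasCompactSupport hφ.compact
  have hI1 : Integrable (fun x => toL2 Ω u x • gradient φ x) (volume.restrict Ω) :=
    memLp_one_iff_integrable.1 (hmg.smul (Lp.memLp (toL2 Ω u)) (r := 1))
  have hI2 : Integrable (fun x => φ x • grad Ω u x) (volume.restrict Ω) :=
    memLp_one_iff_integrable.1 ((Lp.memLp (grad Ω u)).smul hmφ (r := 1))
  refine ext_inner_left ℝ fun w => ?_
  have hA : MemLp (fun x => inner ℝ w (gradient φ x)) 2 (volume.restrict Ω) := hmg.const_inner w
  have hB : MemLp (fun x => φ x • w) 2 (volume.restrict Ω) :=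
    (hφ.smooth.continuous.smul continuous_const).memLp_of_hasCompactSupport
      (hφ.compact.smul_right)
  have hfst : ∀ g : L2 Ω, inner ℝ g (hA.toLp _)
      = ∫ x in Ω, inner ℝ w (gradient φ x) * g x := by
    intro g
    rw [L2.inner_def]
    refine integral_congr_ae ?_
    filter_upwards [hA.coeFn_toLp] with x hx
    rw [hx]
    rfl
  have hsnd : ∀ G : L2vec Ω, inner ℝ G (hB.toLp _) = ∫ x in Ω, φ x * inner ℝ (G x) w := by
    intro G
    rw [L2.inner_def]
    refine integral_congr_ae ?_
    filter_upwards [hB.coeFn_toLp] with x hx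
    rw [hx, real_inner_smul_right]
  have key : ∀ p : L2Pair Ω, p ∈ H10 Ω →
      inner ℝ p.fst (hA.toLp _) + inner ℝ p.snd (hB.toLp _) = 0 := by
    have hcl : IsClosed {p : L2Pair Ω |
        inner ℝ p.fst (hA.toLp _) + inner ℝ p.snd (hB.toLp _) = 0} := by
      refine isClosed_eq ?_ continuous_const
      exact (((WithLp.fstL 2 ℝ (L2 Ω) (L2vec Ω)).continuous).inner continuous_const).add
        (((WithLp.sndL 2 ℝ (L2 Ω) (L2vec Ω)).continuous).inner continuous_const)
    intro p hp
    refine closure_minimal ?_ hcl hp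
    rintro q ⟨ψ, hψ, h1, h2⟩
    have h3 : ∫ x in Ω, inner ℝ w (gradient φ x) * q.fst x = ∫ x, ψ x * fderiv ℝ φ x w := by
      rw [← setIntegral_eq_integral_of_forall_compl_eq_zero (s := Ω)
        (f := fun x => ψ x * fderiv ℝ φ x w)]
      · refine integral_congr_ae ?_
        filter_upwards [h1] with x hx
        rw [hx, real_inner_comm, inner_gradient_left, mul_comm]
      · intro x hx
        rw [image_eq_zero_of_notMem_tsupport (fun h => hx (hψ.supp h)), zero_mul]
    have h4 : ∫ x in Ω, φ x * inner ℝ (q.snd x) w = ∫ x, fderiv ℝ ψ x w * φ x := by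
      rw [← setIntegral_eq_integral_of_forall_compl_eq_zero (s := Ω)
        (f := fun x => fderiv ℝ ψ x w * φ x)]
      · refine integral_congr_ae ?_
        filter_upwards [h2] with x hx
        rw [hx, inner_gradient_left, mul_comm]
      · intro x hx
        rw [image_eq_zero_of_notMem_tsupport (fun h => hx (hφ.supp h)), mul_zero]
    have hcφ := (hφ.smooth.continuous_fderiv (by simp)).clm_apply
      (continuous_const (y := w))
    have hcψ := (hψ.smooth.continuous_fderiv (by simp)).clm_apply
      (continuous_const (y := w))
    change inner ℝ q.fst (hA.toLp _) + inner ℝ q.snd (hB.toLp _) = 0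
    rw [hfst, hsnd, h3, h4, integral_mul_fderiv_eq_neg_fderiv_mul_of_integrable]
    · simp
    · exact (hcψ.mul hφ.smooth.continuous).integrable_of_hasCompactSupport hφ.compact.mul_left
    · exact (hψ.smooth.continuous.mul hcφ).integrable_of_hasCompactSupport hψ.compact.mul_right
    · exact (hψ.smooth.continuous.mul hφ.smooth.continuous).integrable_of_hasCompactSupport
        hφ.compact.mul_left
    · exact fun x _ => hψ.smooth.differentiable (by simp) x
    · exact fun x _ => hφ.smooth.differentiable (by simp) x
  have hu := key u u.2
  rw [hfst, hsnd] at hu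
  rw [inner_neg_right, ← integral_inner hI1, ← integral_inner hI2]
  have e1 : ∫ x in Ω, inner ℝ w (toL2 Ω u x • gradient φ x)
      = ∫ x in Ω, inner ℝ w (gradient φ x) * (u : L2Pair Ω).fst x :=
    integral_congr_ae (Filter.Eventually.of_forall fun x => by
      simp only [real_inner_smul_right]; exact mul_comm _ _)
  have e2 : ∫ x in Ω, inner ℝ w (φ x • grad Ω u x)
      = ∫ x in Ω, φ x * inner ℝ ((u : L2Pair Ω).snd x) w :=
    integral_congr_ae (Filter.Eventually.of_forall fun x => by
      simp only [real_inner_smul_right]; rw [real_inner_comm]; rfl)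
  rw [e1, e2]
  linarith

/-- `H⁻¹(Ω)`, the topological dual of `H¹₀(Ω)`. -/
abbrev Hm1 {n : ℕ} (Ω : Set (E n)) : Type := StrongDual ℝ (H10 Ω)

/-- The embedding `L²(Ω) → H⁻¹(Ω)`, `⟨g, v⟩ = (g, v)_{L²(Ω)}`. -/
def toHm1 {n : ℕ} (Ω : Set (E n)) (g : L2 Ω) : Hm1 Ω := (innerSL ℝ g).comp (toL2 Ω)

/-- Lebesgue measure on the time half-line `[0, +∞[`. -/
abbrev timeMeasure : Measure ℝ := volume.restrict (Ici 0)

/-- The Bochner space `L²([0, +∞[; X)`. -/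
abbrev L2Time (X : Type) [NormedAddCommGroup X] : Type := Lp X 2 timeMeasure

/-- `w` is the weak derivative of the `X`-valued function `u` on `]0, +∞[`:
`∫ φ' u = - ∫ φ w` in `X` for all `φ ∈ C_c^∞(]0, +∞[)`. -/
def IsWeakTimeDeriv {X : Type} [NormedAddCommGroup X] [NormedSpace ℝ X] (u w : ℝ → X) : Prop :=
  ∀ φ : ℝ → ℝ, IsTest (Ioi 0) φ →
    ∫ t, deriv φ t • u t ∂timeMeasure = -∫ t, φ t • w t ∂timeMeasure

/-- The initial value of (the class of) `u` is `a`: it has a representative that is continuous on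
`[0, +∞[` with values in `X` and takes the value `a` at `0`. -/
def HasInitialValue {X : Type} [NormedAddCommGroup X] (u : ℝ → X) (a : X) : Prop :=
  ∃ u' : ℝ → X, ContinuousOn u' (Ici 0) ∧ u' =ᵐ[timeMeasure] u ∧ u' 0 = a

/-- `u ∈ L²([0, +∞[; H¹₀(Ω))` is a weak solution of `∂ₜ²u - c² Δu - εν Δ∂ₜu = f` on
`]0, +∞[ × Ω` with `u = 0` on the boundary and `u(0) = u₀`, `∂ₜu(0) = u₁`. Here `ut` is `∂ₜu`, in
`L²([0, +∞[; H¹₀(Ω))`, and `utt` is `∂ₜ²u`, in `L²([0, +∞[; H⁻¹(Ω))`. -/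
def IsWeakSolution {n : ℕ} (Ω : Set (E n)) (c ε ν : ℝ) (f : L2Time (L2 Ω)) (u₀ : H10 Ω)
    (u₁ : L2 Ω) (u : L2Time (H10 Ω)) : Prop :=
  ∃ (ut : L2Time (H10 Ω)) (utt : L2Time (Hm1 Ω)),
    IsWeakTimeDeriv u ut ∧
    IsWeakTimeDeriv (fun t => toHm1 Ω (toL2 Ω (ut t))) utt ∧
    HasInitialValue u u₀ ∧
    HasInitialValue (fun t => toL2 Ω (ut t)) u₁ ∧
    ∀ v : L2Time (H10 Ω),
      ∫ t, (utt t (v t) + c ^ 2 * inner ℝ (grad Ω (u t)) (grad Ω (v t))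
          + ε * ν * inner ℝ (grad Ω (ut t)) (grad Ω (v t))) ∂timeMeasure
        = ∫ t, inner ℝ (f t) (toL2 Ω (v t)) ∂timeMeasure

end DampedWave

end

noncomputable section

namespace DampedWave

/-! Put V = H¹₀(Ω), H = L²(Ω), j = `toL2 Ω`, G = `grad Ω`, a = c², b = εν. By Riesz the forms (jx,
jy) and (Gx, Gy) become bounded operators K = j†j and A = G†G on V, and the problem reads K u'' + b
A u' + a A u = j† f in V. Poincaré's inequality makes A coercive. The remaining difficulty for
existence is that K need not be invertible.

Existence. With K + δ in place of K this is a linear ODE in V with bounded coefficients. A modified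
energy (`exists_energy_le`) controls u and u' in L²([0,+∞[; V), with a constant that sees K only
through an upper bound. Testing with u'' bounds δ∫‖u''‖²
(`IsClassicalSolution.integral_second_deriv_le`), so δu'' tends to 0 in L²; moved to the right-hand
side, it shows that the original equation has classical solutions for data arbitrarily close to the
given ones (`exists_isClassicalSolution_near`). The energy estimate for δ = 0, applied to
differences, makes these solutions Cauchy, and their limit is the weak solution
(`exists_weakSolution`).

Uniqueness. Testing with exp(-st) x turns the weak formulation into an elliptic identity for the
Laplace transform of u (`integral_weakForm_exp_smul`). Two solutions therefore have the same
transform at every s > 0 (`eq_of_laplace_eq`), and the transform is injective by Weierstrass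
approximation (`ae_eq_zero_of_integral_exp_smul`). -/

/-! ### Poincaré's inequality and density of H¹₀ in L². -/

theorem IsTest.integral_sq_le {n : ℕ} (hn : 1 ≤ n) {Ω : Set (E n)} {R : ℝ}
    (hR : ∀ x ∈ Ω, ‖x‖ ≤ R) {φ : E n → ℝ} (hφ : IsTest Ω φ) :
    ∫ x, φ x ^ 2 ≤ 4 * R ^ 2 * ∫ x, ‖gradient φ x‖ ^ 2 := by
  let i : Fin n := ⟨0, hn⟩
  let e : E n := EuclideanSpace.single i 1
  have he : ‖e‖ = 1 := by simp [e]
  let ℓ : E n →L[ℝ] ℝ := innerSL ℝ e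
  have hd : Differentiable ℝ φ := hφ.smooth.differentiable (by simp)
  have hc := hφ.smooth.continuous
  have hcd : Continuous fun x => fderiv ℝ φ x e :=
    (hφ.smooth.continuous_fderiv (by simp)).clm_apply continuous_const
  have hcs : HasCompactSupport fun x => φ x * φ x := hφ.compact.mul_left
  have hD : ∀ x, fderiv ℝ (fun x => φ x * φ x) x e = 2 * (φ x * fderiv ℝ φ x e) := by
    intro x
    rw [fderiv_fun_mul (hd x) (hd x)]
    simp only [add_apply, smul_apply, smul_eq_mul]
    ring
  have hℓ : ∀ x, fderiv ℝ (⇑ℓ) x e = 1 := by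
    intro x
    rw [ContinuousLinearMap.fderiv]
    simp [ℓ, he]
  -- The linear function ℓ has derivative 1 along e and |ℓ| ≤ R on Ω, so integrating φ² against it
  -- by parts gives ∫φ² = -2∫ φ (∂ₑφ) ℓ.
  have key := integral_mul_fderiv_eq_neg_fderiv_mul_of_integrable (μ := volume)
    (f := fun x => φ x * φ x) (g := ⇑ℓ) (v := e)
    (by
      simp_rw [hD]
      exact (((continuous_const.mul (hc.mul hcd)).mul ℓ.continuous)).integrable_of_hasCompactSupport
        ((hφ.compact.mul_right.mul_left).mul_right))
    (by
      simp_rw [hℓ, mul_one]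
      exact (hc.mul hc).integrable_of_hasCompactSupport hcs)
    (((hc.mul hc).mul ℓ.continuous).integrable_of_hasCompactSupport hcs.mul_right)
    (fun x _ => (hd x).mul (hd x)) (fun x _ => ℓ.differentiableAt)
  simp_rw [hD, hℓ, mul_one] at key
  have hi1 : Integrable fun x => φ x ^ 2 := by
    simp_rw [pow_two]
    exact (hc.mul hc).integrable_of_hasCompactSupport hcs
  have hi2 : Integrable fun x => ‖gradient φ x‖ ^ 2 := by
    have hg := hφ.continuous_gradient.norm
    have hg' : HasCompactSupport fun x => ‖gradient φ x‖ := hφ.compact_gradient.norm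
    simp_rw [pow_two]
    exact (hg.mul hg).integrable_of_hasCompactSupport hg'.mul_right
  have hi3 : Integrable fun x => -(2 * (φ x * fderiv ℝ φ x e) * ℓ x) :=
    (((continuous_const.mul (hc.mul hcd)).mul ℓ.continuous).integrable_of_hasCompactSupport
      (hφ.compact.mul_right.mul_left.mul_right)).neg
  -- Young's inequality with weight 1/2 on φ², so that half of ∫φ² is absorbed on the left; this
  -- doubles 2R² to 4R².
  have hpt : ∀ x, -(2 * (φ x * fderiv ℝ φ x e) * ℓ x)
      ≤ 1 / 2 * φ x ^ 2 + 2 * R ^ 2 * ‖gradient φ x‖ ^ 2 := by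
    intro x
    by_cases hx : x ∈ Ω
    · have h1 : |ℓ x| ≤ R := by
        have := abs_real_inner_le_norm e x
        rw [he, one_mul] at this
        exact this.trans (hR x hx)
      have h2 : |fderiv ℝ φ x e| ≤ ‖gradient φ x‖ := by
        rw [← inner_gradient_left]
        simpa [he] using abs_real_inner_le_norm (gradient φ x) e
      revert h1 h2
      generalize fderiv ℝ φ x e = d, ℓ x = l, ‖gradient φ x‖ = G, φ x = p
      intro h1 h2
      have h3 : |d * l| ≤ G * R := by
        rw [abs_mul]
        exact mul_le_mul h2 h1 (abs_nonneg _) ((abs_nonneg _).trans h2)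
      have h4 : (d * l) ^ 2 ≤ (G * R) ^ 2 := sq_le_sq' (abs_le.1 h3).1 (abs_le.1 h3).2
      nlinarith [sq_nonneg (p + 2 * (d * l))]
    · have h0 : φ x = 0 := image_eq_zero_of_notMem_tsupport fun h => hx (hφ.supp h)
      rw [h0]
      norm_num
      positivity
  have hle : ∫ x, φ x ^ 2 ≤ ∫ x, (1 / 2 * φ x ^ 2 + 2 * R ^ 2 * ‖gradient φ x‖ ^ 2) := by
    calc ∫ x, φ x ^ 2 = ∫ x, -(2 * (φ x * fderiv ℝ φ x e) * ℓ x) := by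
          rw [integral_neg, ← key]; simp_rw [pow_two]
      _ ≤ _ := integral_mono hi3 ((hi1.const_mul _).add (hi2.const_mul _)) hpt
  rw [integral_add (hi1.const_mul _) (hi2.const_mul _), integral_const_mul,
    integral_const_mul] at hle
  linarith

theorem norm_sq_Lp_two {α F : Type*} [MeasurableSpace α] {μ : Measure α} [NormedAddCommGroup F]
    [InnerProductSpace ℝ F] (g : Lp F 2 μ) : ‖g‖ ^ 2 = ∫ x, ‖g x‖ ^ 2 ∂μ := by
  rw [← real_inner_self_eq_norm_sq, L2.inner_def]
  simp_rw [real_inner_self_eq_norm_sq]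

theorem norm_sq_eq_toL2_add_grad {n : ℕ} {Ω : Set (E n)} (u : H10 Ω) :
    ‖u‖ ^ 2 = ‖toL2 Ω u‖ ^ 2 + ‖grad Ω u‖ ^ 2 :=
  WithLp.prod_norm_sq_eq_of_L2 (u : L2Pair Ω)

/-- Poincaré's inequality on a bounded open set. -/
theorem exists_norm_toL2_sq_le {n : ℕ} (hn : 1 ≤ n) {Ω : Set (E n)}
    (hΩ_bdd : Bornology.IsBounded Ω) :
    ∃ C : ℝ, 0 ≤ C ∧ ∀ u : H10 Ω, ‖toL2 Ω u‖ ^ 2 ≤ C * ‖grad Ω u‖ ^ 2 := by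
  obtain ⟨R, hR⟩ := hΩ_bdd.exists_norm_le
  refine ⟨4 * R ^ 2, by positivity, ?_⟩
  have hcl : IsClosed {p : L2Pair Ω | ‖p.fst‖ ^ 2 ≤ 4 * R ^ 2 * ‖p.snd‖ ^ 2} :=
    isClosed_le ((WithLp.fstL 2 ℝ (L2 Ω) (L2vec Ω)).continuous.norm.pow 2)
      (continuous_const.mul ((WithLp.sndL 2 ℝ (L2 Ω) (L2vec Ω)).continuous.norm.pow 2))
  rintro ⟨p, hp⟩
  refine closure_minimal ?_ hcl hp
  rintro q ⟨φ, hφ, h1, h2⟩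
  have e1 : ‖q.fst‖ ^ 2 = ∫ x, φ x ^ 2 := by
    rw [norm_sq_Lp_two, ← setIntegral_eq_integral_of_forall_compl_eq_zero (s := Ω)
      (f := fun x => φ x ^ 2)]
    · refine integral_congr_ae ?_
      filter_upwards [h1] with x hx
      rw [hx, Real.norm_eq_abs, sq_abs]
    · intro x hx
      rw [image_eq_zero_of_notMem_tsupport fun h => hx (hφ.supp h)]
      norm_num
  have e2 : ‖q.snd‖ ^ 2 = ∫ x, ‖gradient φ x‖ ^ 2 := by
    rw [norm_sq_Lp_two, ← setIntegral_eq_integral_of_forall_compl_eq_zero (s := Ω)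
      (f := fun x => ‖gradient φ x‖ ^ 2)]
    · refine integral_congr_ae ?_
      filter_upwards [h2] with x hx
      rw [hx]
    · intro x hx
      have : fderiv ℝ φ x = 0 := image_eq_zero_of_notMem_tsupport fun h =>
        hx (hφ.supp (tsupport_fderiv_subset ℝ h))
      simp [gradient, this]
  change ‖q.fst‖ ^ 2 ≤ 4 * R ^ 2 * ‖q.snd‖ ^ 2
  rw [e1, e2]
  exact hφ.integral_sq_le hn hR

/-- `H¹₀(Ω)` is dense in `L²(Ω)`. -/
theorem denseRange_toL2 {n : ℕ} {Ω : Set (E n)} (hΩ : IsOpen Ω) : DenseRange (toL2 Ω) := by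
  have : (LinearMap.range (toL2 Ω).toLinearMap).topologicalClosure = ⊤ := by
    rw [Submodule.topologicalClosure_eq_top_iff, Submodule.eq_bot_iff]
    intro g hg
    -- A g orthogonal to the range is orthogonal to every test function φ, as (φ, ∇φ) lies in H¹₀;
    -- the fundamental lemma of the calculus of variations applies.
    have h0 : ∀ᵐ x ∂(volume.restrict Ω), x ∈ Ω → g x = 0 := by
      refine hΩ.ae_eq_zero_of_integral_contDiff_smul_eq_zero
        (((Lp.memLp g).locallyIntegrable (by norm_num)).locallyIntegrableOn _) fun φ h1 h2 h3 => ?_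
      have hφ : IsTest Ω φ := ⟨h1, h2, h3⟩
      have hmg : MemLp (gradient φ) 2 (volume.restrict Ω) :=
        hφ.continuous_gradient.memLp_of_hasCompactSupport hφ.compact_gradient
      have hmφ : MemLp φ 2 (volume.restrict Ω) := h1.continuous.memLp_of_hasCompactSupport h2
      let p : H10 Ω := ⟨WithLp.toLp 2 (hmφ.toLp φ, hmg.toLp _),
        Submodule.le_topologicalClosure _ ⟨φ, hφ, hmφ.coeFn_toLp, hmg.coeFn_toLp⟩⟩
      have hp := (Submodule.mem_orthogonal _ _).1 hg (toL2 Ω p) ⟨p, rfl⟩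
      rw [L2.inner_def] at hp
      rw [← hp]
      refine integral_congr_ae ?_
      filter_upwards [hmφ.coeFn_toLp] with x hx
      change φ x * g x = inner ℝ (hmφ.toLp φ x) (g x)
      rw [hx, mul_comm]
      rfl
    refine Lp.ext ?_
    filter_upwards [h0, Lp.coeFn_zero ℝ 2 (volume.restrict Ω),
      ae_restrict_mem hΩ.measurableSet] with x hx h0 hxΩ
    rw [hx hxΩ, h0, Pi.zero_apply]
  exact Submodule.dense_iff_topologicalClosure_eq_top.2 this

/-! ### Linear ODEs and integrals over the half-line. -/

open Filter Topology

/-- Variation of constants for `U' = M U + F` with bounded `M`. -/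
theorem exists_hasDerivAt_linear {X : Type*} [NormedAddCommGroup X] [NormedSpace ℝ X]
    [CompleteSpace X] (M : X →L[ℝ] X) {F : ℝ → X} (hF : Continuous F) (x₀ : X) :
    ∃ U : ℝ → X, U 0 = x₀ ∧ ∀ t, HasDerivAt U (M (U t) + F t) t := by
  let S : ℝ → X →L[ℝ] X := fun t => NormedSpace.exp (t • M)
  have hS : ∀ t, HasDerivAt S (M * S t) t := fun t => hasDerivAt_exp_smul_const' M t
  have hSc : Continuous S := continuous_iff_continuousAt.2 fun t => (hS t).continuousAt
  have hSinv : ∀ t, S t * S (-t) = 1 := by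
    intro t
    have hcomm : Commute (t • M) ((-t) • M) := ((Commute.refl M).smul_left t).smul_right (-t)
    let : NormedAlgebra ℚ (X →L[ℝ] X) := NormedAlgebra.restrictScalars ℚ ℝ _
    have := NormedSpace.exp_add_of_commute hcomm
    simp only [S]
    rw [← this, neg_smul, add_neg_cancel, NormedSpace.exp_zero]
  have hG : Continuous fun s => S (-s) (F s) := (hSc.comp continuous_neg).clm_apply hF
  refine ⟨fun t => S t (x₀ + ∫ s in (0 : ℝ)..t, S (-s) (F s)), ?_, fun t => ?_⟩
  · simp [S]
  · have h1 : HasDerivAt (fun t => x₀ + ∫ s in (0 : ℝ)..t, S (-s) (F s)) (S (-t) (F t)) t :=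
      (intervalIntegral.integral_hasDerivAt_right (hG.intervalIntegrable _ _)
        hG.aestronglyMeasurable.stronglyMeasurableAtFilter hG.continuousAt).const_add x₀
    have h2 := (hS t).clm_apply h1
    convert h2 using 1
    have := congrArg (fun B : X →L[ℝ] X => B (F t)) (hSinv t)
    exact congrArg (_ + ·) this.symm

/-- Integrated form of a differential inequality: Φ is an energy, D its dissipation, G the source.
-/
theorem add_integral_le_of_deriv_add_le {Φ Φ' D G : ℝ → ℝ} (hΦ : ∀ t, HasDerivAt Φ (Φ' t) t)
    (hΦ' : Continuous Φ') (hD : Continuous D) (hG : Continuous G) (h : ∀ t, Φ' t + D t ≤ G t)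
    {T : ℝ} (hT : 0 ≤ T) :
    Φ T + ∫ t in (0 : ℝ)..T, D t ≤ Φ 0 + ∫ t in (0 : ℝ)..T, G t := by
  have h1 : ∫ t in (0 : ℝ)..T, Φ' t = Φ T - Φ 0 :=
    intervalIntegral.integral_eq_sub_of_hasDerivAt (fun t _ => hΦ t) (hΦ'.intervalIntegrable _ _)
  have h2 : ∫ t in (0 : ℝ)..T, (Φ' t + D t) ≤ ∫ t in (0 : ℝ)..T, G t :=
    intervalIntegral.integral_mono hT ((hΦ'.add hD).intervalIntegrable _ _)
      (hG.intervalIntegrable _ _) h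
  rw [intervalIntegral.integral_add (hΦ'.intervalIntegrable _ _) (hD.intervalIntegrable _ _)] at h2
  linarith

theorem integrable_timeMeasure_of_forall_integral_le {q : ℝ → ℝ} (hq : Continuous q)
    (hq0 : ∀ t, 0 ≤ q t) {I : ℝ} (h : ∀ T, 0 ≤ T → ∫ t in (0 : ℝ)..T, q t ≤ I) :
    Integrable q timeMeasure ∧ ∫ t, q t ∂timeMeasure ≤ I := by
  have h1 : IntegrableOn q (Ioi 0) := by
    refine integrableOn_Ioi_of_intervalIntegral_norm_bounded (l := atTop) (b := id) I 0
      (fun T => (hq.integrableOn_Icc (a := 0) (b := T)).mono_set Ioc_subset_Icc_self)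
      tendsto_id ?_
    filter_upwards [eventually_ge_atTop 0] with T hT
    simp_rw [Real.norm_eq_abs, abs_of_nonneg (hq0 _)]
    exact h T hT
  have h2 : IntegrableOn q (Ici 0) := (integrableOn_Ici_iff_integrableOn_Ioi (by simp)).2 h1
  refine ⟨h2, ?_⟩
  change ∫ t in Ici 0, q t ≤ I
  rw [integral_Ici_eq_integral_Ioi]
  refine le_of_tendsto (intervalIntegral_tendsto_integral_Ioi 0 h1 tendsto_id) ?_
  filter_upwards [eventually_ge_atTop 0] with T hT using h T hT

theorem intervalIntegral_le_integral_timeMeasure {q : ℝ → ℝ} (hq : Integrable q timeMeasure)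
    (hq0 : ∀ t, 0 ≤ q t) {T : ℝ} (hT : 0 ≤ T) :
    ∫ t in (0 : ℝ)..T, q t ≤ ∫ t, q t ∂timeMeasure := by
  rw [intervalIntegral.integral_of_le hT]
  exact setIntegral_mono_set hq (Eventually.of_forall hq0)
    (Ioc_subset_Icc_self.trans Icc_subset_Ici_self).eventuallyLE

/-! ### The second-order ODE in a Hilbert space and its energy estimate. -/

section Energy

variable {V : Type} [NormedAddCommGroup V] [InnerProductSpace ℝ V]

/-- `u` is a `C²` solution of `K u'' + b A u' + a A u = g`, with `v = u'` and `w = u''`. -/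
structure IsClassicalSolution (K A : V →L[ℝ] V) (a b : ℝ) (u v w g : ℝ → V) : Prop where
  hasDerivAt : ∀ t, HasDerivAt u (v t) t
  hasDerivAt' : ∀ t, HasDerivAt v (w t) t
  continuous : Continuous w
  equation : ∀ t, K (w t) + b • A (v t) + a • A (u t) = g t

namespace IsClassicalSolution

variable {K A : V →L[ℝ] V} {a b : ℝ} {u v w g : ℝ → V}

theorem continuous_fst (h : IsClassicalSolution K A a b u v w g) : Continuous u :=
  continuous_iff_continuousAt.2 fun t => (h.hasDerivAt t).continuousAt

theorem continuous_snd (h : IsClassicalSolution K A a b u v w g) : Continuous v :=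
  continuous_iff_continuousAt.2 fun t => (h.hasDerivAt' t).continuousAt

theorem continuous_rhs (h : IsClassicalSolution K A a b u v w g) : Continuous g := by
  rw [← funext h.equation]
  have := h.continuous
  have := h.continuous_fst
  have := h.continuous_snd
  fun_prop

theorem sub (h : IsClassicalSolution K A a b u v w g) {u' v' w' g' : ℝ → V}
    (h' : IsClassicalSolution K A a b u' v' w' g') :
    IsClassicalSolution K A a b (fun t => u t - u' t) (fun t => v t - v' t)
      (fun t => w t - w' t) (fun t => g t - g' t) where
  hasDerivAt t := (h.hasDerivAt t).sub (h'.hasDerivAt t)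
  hasDerivAt' t := (h.hasDerivAt' t).sub (h'.hasDerivAt' t)
  continuous := h.continuous.sub h'.continuous
  equation t := by
    rw [← h.equation, ← h'.equation]
    simp only [map_sub, smul_sub]
    abel

end IsClassicalSolution

theorem exists_isClassicalSolution [CompleteSpace V] {K : V →L[ℝ] V} (A : V →L[ℝ] V) (a b : ℝ)
    {δ : ℝ} (hδ : 0 < δ) (hK : ∀ x, δ * ‖x‖ ^ 2 ≤ inner ℝ (K x) x) {g : ℝ → V}
    (hg : Continuous g) (u₀ v₀ : V) :
    ∃ u v w : ℝ → V, IsClassicalSolution K A a b u v w g ∧ u 0 = u₀ ∧ v 0 = v₀ := by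
  -- Lax–Milgram inverts K, which makes the equation a first-order system on V × V with a bounded
  -- generator.
  have hco : IsCoercive ((innerSL ℝ).comp K) := ⟨δ, hδ, fun x => by
    have := hK x
    rw [pow_two, ← mul_assoc] at this
    exact this⟩
  let B := hco.continuousLinearEquivOfBilin
  have hB : ∀ x, B x = K x := by
    intro x
    refine ext_inner_right ℝ fun y => ?_
    rw [hco.continuousLinearEquivOfBilin_apply]
    rfl
  let Bi : V →L[ℝ] V := B.symm
  have hBi : ∀ x, K (Bi x) = x := fun x => by rw [← hB]; exact B.apply_symm_apply x
  let M : V × V →L[ℝ] V × V := (ContinuousLinearMap.snd ℝ V V).prod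
    (Bi.comp (-(b • A.comp (ContinuousLinearMap.snd ℝ V V))
      - a • A.comp (ContinuousLinearMap.fst ℝ V V)))
  obtain ⟨U, hU0, hU⟩ := exists_hasDerivAt_linear M (F := fun t => (0, Bi (g t)))
    (continuous_const.prodMk (Bi.continuous.comp hg)) (u₀, v₀)
  have h1 : ∀ t, HasDerivAt (fun t => (U t).1) (U t).2 t := fun t => by
    exact ((ContinuousLinearMap.fst ℝ V V).hasFDerivAt.comp_hasDerivAt t (hU t)).congr_deriv
      (by simp [M])
  have h2 : ∀ t, HasDerivAt (fun t => (U t).2)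
      (Bi (-(b • A (U t).2) - a • A (U t).1) + Bi (g t)) t := fun t => by
    exact ((ContinuousLinearMap.snd ℝ V V).hasFDerivAt.comp_hasDerivAt t (hU t)).congr_deriv
      (by simp [M])
  have hc : Continuous U := continuous_iff_continuousAt.2 fun t => (hU t).continuousAt
  refine ⟨_, _, _, ⟨h1, h2, by fun_prop, fun t => ?_⟩, by simp [hU0], by simp [hU0]⟩
  rw [map_add, hBi, hBi]
  abel

/-- Energy estimate, with a constant that depends on `K` only through the bound `κ`. -/
theorem exists_energy_le (A : V →L[ℝ] V) {a b α κ : ℝ} (ha : 0 < a) (hb : 0 < b) (hα : 0 < α)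
    (hκ : 0 < κ) (hAs : ∀ x y, inner ℝ (A x) y = inner ℝ x (A y))
    (hA : ∀ x, α * ‖x‖ ^ 2 ≤ inner ℝ (A x) x) :
    ∃ C : ℝ, 0 < C ∧ ∀ K : V →L[ℝ] V, (∀ x y, inner ℝ (K x) y = inner ℝ x (K y)) →
      (∀ x, 0 ≤ inner ℝ (K x) x) → (∀ x, inner ℝ (K x) x ≤ κ * ‖x‖ ^ 2) →
      ∀ u v w g : ℝ → V, IsClassicalSolution K A a b u v w g → ∀ T, 0 ≤ T →
        inner ℝ (K (v T)) (v T) + ‖u T‖ ^ 2 + ∫ t in (0 : ℝ)..T, (‖u t‖ ^ 2 + ‖v t‖ ^ 2)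
          ≤ C * (‖u 0‖ ^ 2 + inner ℝ (K (v 0)) (v 0) + ∫ t in (0 : ℝ)..T, ‖g t‖ ^ 2) := by
  -- Chosen so that η(Kv, v) ≤ (bα/2)‖v‖², that is, half of the damping pays for the bad term that
  -- the cross term of Φ creates.
  obtain ⟨η, hη⟩ : ∃ η, η = b * α / (2 * κ) := ⟨_, rfl⟩
  have hη0 : 0 < η := by rw [hη]; positivity
  have hηκ : η * κ = b * α / 2 := by rw [hη]; field_simp
  -- The first two bounds make Φ control m((Kv, v) + ‖u‖²); the last two are the dissipation of v
  -- and of u that is left after Young's inequality.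
  obtain ⟨m, hm0, hm1, hm2, hm3, hm4⟩ : ∃ m : ℝ, 0 < m ∧ m ≤ 1 / 4 ∧ m ≤ a * α / 2 ∧
      m ≤ b * α / 4 ∧ m ≤ η * a * α / 2 := by
    refine ⟨min (min (1 / 4) (a * α / 2)) (min (b * α / 4) (η * a * α / 2)),
      by positivity, ?_, ?_, ?_, ?_⟩ <;> simp
  -- The first two bounds serve the upper estimate of Φ 0; the third collects the coefficients of
  -- ‖g‖².
  obtain ⟨N, hN1, hN2, hN3⟩ : ∃ N : ℝ, 1 ≤ N ∧ η ^ 2 * κ + (a + η * b) / 2 * ‖A‖ ≤ N ∧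
      1 / (b * α) + η / (2 * a * α) ≤ N := by
    refine ⟨1 + (η ^ 2 * κ + (a + η * b) / 2 * ‖A‖) + (1 / (b * α) + η / (2 * a * α)), ?_, ?_, ?_⟩
    all_goals
      have h1 : 0 ≤ η ^ 2 * κ + (a + η * b) / 2 * ‖A‖ := by positivity
      have h2 : 0 ≤ 1 / (b * α) + η / (2 * a * α) := by positivity
      linarith
  refine ⟨N / m, by positivity, fun K hKs hK0 hKκ u v w g h T hT => ?_⟩
  have hcu := h.continuous_fst
  have hcv := h.continuous_snd
  have hcw := h.continuous
  have hcg := h.continuous_rhs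
  -- The natural energy dissipates only v. The cross term η(Kv, u) adds the dissipation ηa(Au, u),
  -- and the extra (ηb/2)(Au, u) cancels the term -ηb(Av, u) that it also produces.
  let Φ : ℝ → ℝ := fun t => 1 / 2 * inner ℝ (K (v t)) (v t) +
    (a + η * b) / 2 * inner ℝ (A (u t)) (u t)
    + η * inner ℝ (K (v t)) (u t)
  let Φ' : ℝ → ℝ := fun t => 1 / 2 * (inner ℝ (K (v t)) (w t) + inner ℝ (K (w t)) (v t))
    + (a + η * b) / 2 * (inner ℝ (A (u t)) (v t) + inner ℝ (A (v t)) (u t))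
    + η * (inner ℝ (K (v t)) (v t) + inner ℝ (K (w t)) (u t))
  have hΦ : ∀ t, HasDerivAt Φ (Φ' t) t := by
    intro t
    have hu := h.hasDerivAt t
    have hv := h.hasDerivAt' t
    have hKv := K.hasFDerivAt.comp_hasDerivAt t hv
    have hAu := A.hasFDerivAt.comp_hasDerivAt t hu
    exact ((((hKv.inner ℝ hv).const_mul (1 / 2)).add ((hAu.inner ℝ hu).const_mul _)).add
      ((hKv.inner ℝ hu).const_mul η))
  have key := add_integral_le_of_deriv_add_le hΦ (D := fun t => m * (‖u t‖ ^ 2 + ‖v t‖ ^ 2))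
    (G := fun t => N * ‖g t‖ ^ 2) (by fun_prop) (by fun_prop) (by fun_prop) (fun t => ?_) hT
  · rw [intervalIntegral.integral_const_mul, intervalIntegral.integral_const_mul] at key
    -- Positivity of K at y + c x. With c = ±2η it bounds the cross term by (Kv, v)/4 + η²(Ku, u),
    -- and η²κ = ηbα/2 lets (ηb/2)(Au, u) absorb the last term from below.
    have hcs : ∀ c x y, 0 ≤ inner ℝ (K y) y + 2 * c * inner ℝ (K y) x + c ^ 2 * inner ℝ (K x) x := by
      intro c x y
      have := hK0 (y + c • x)
      simp only [map_add, map_smul, inner_add_left, inner_add_right, real_inner_smul_left,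
        real_inner_smul_right] at this
      rw [hKs x y, real_inner_comm (K y) x] at this
      linarith
    have hlow : m * (inner ℝ (K (v T)) (v T) + ‖u T‖ ^ 2) ≤ Φ T := by
      have h1 := hcs (2 * η) (u T) (v T)
      have h2 := mul_le_mul_of_nonneg_left (hKκ (u T)) (sq_nonneg η)
      have h3 := mul_le_mul_of_nonneg_left (hA (u T)) (show 0 ≤ (a + η * b) / 2 by positivity)
      have h4 := mul_le_mul_of_nonneg_right hm1 (hK0 (v T))
      have h5 := mul_le_mul_of_nonneg_right hm2 (sq_nonneg ‖u T‖)
      have h6 : η ^ 2 * (κ * ‖u T‖ ^ 2) = η * b * α / 2 * ‖u T‖ ^ 2 := by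
        linear_combination (η * ‖u T‖ ^ 2) * hηκ
      simp only [Φ]
      nlinarith
    have hup : Φ 0 ≤ N * (‖u 0‖ ^ 2 + inner ℝ (K (v 0)) (v 0)) := by
      have h1 := hcs (-(2 * η)) (u 0) (v 0)
      have h2 := mul_le_mul_of_nonneg_left (hKκ (u 0)) (sq_nonneg η)
      have h3 : inner ℝ (A (u 0)) (u 0) ≤ ‖A‖ * ‖u 0‖ ^ 2 := by
        refine (real_inner_le_norm _ _).trans ?_
        rw [pow_two, ← mul_assoc]
        exact mul_le_mul_of_nonneg_right (A.le_opNorm _) (norm_nonneg _)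
      have h3' := mul_le_mul_of_nonneg_left h3 (show 0 ≤ (a + η * b) / 2 by positivity)
      have h4 := mul_le_mul_of_nonneg_right hN1 (hK0 (v 0))
      have h5 := mul_le_mul_of_nonneg_right hN2 (sq_nonneg ‖u 0‖)
      have h6 := hK0 (v 0)
      simp only [Φ]
      nlinarith
    rw [div_mul_eq_mul_div, le_div_iff₀ hm0]
    linarith
  · have e := h.equation t
    have e1 : inner ℝ (K (w t)) (v t) = inner ℝ (g t) (v t) - b * inner ℝ (A (v t)) (v t)
        - a * inner ℝ (A (u t)) (v t) := by
      rw [← e]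
      simp only [inner_add_left, real_inner_smul_left]
      ring
    have e2 : inner ℝ (K (w t)) (u t) = inner ℝ (g t) (u t) - b * inner ℝ (A (v t)) (u t)
        - a * inner ℝ (A (u t)) (u t) := by
      rw [← e]
      simp only [inner_add_left, real_inner_smul_left]
      ring
    have e3 : inner ℝ (K (v t)) (w t) = inner ℝ (K (w t)) (v t) := by
      rw [hKs, real_inner_comm]
    have e4 : inner ℝ (A (v t)) (u t) = inner ℝ (A (u t)) (v t) := by
      rw [hAs, real_inner_comm]
    have e5 : Φ' t = inner ℝ (g t) (v t) - b * inner ℝ (A (v t)) (v t)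
        + η * inner ℝ (g t) (u t) - η * a * inner ℝ (A (u t)) (u t)
        + η * inner ℝ (K (v t)) (v t) := by
      simp only [Φ']
      rw [e3, e4, e2, e1, e4]
      ring
    have f1 : inner ℝ (g t) (v t) ≤ 1 / (b * α) * ‖g t‖ ^ 2 + b * α / 4 * ‖v t‖ ^ 2 := by
      refine (real_inner_le_norm _ _).trans ?_
      have : 1 / (b * α) * ‖g t‖ ^ 2 + b * α / 4 * ‖v t‖ ^ 2 - ‖g t‖ * ‖v t‖
          = 1 / (b * α) * (‖g t‖ - b * α / 2 * ‖v t‖) ^ 2 := by field_simp; ring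
      have h0 : 0 ≤ 1 / (b * α) * (‖g t‖ - b * α / 2 * ‖v t‖) ^ 2 := by positivity
      linarith
    have f2 : η * inner ℝ (g t) (u t)
        ≤ η / (2 * a * α) * ‖g t‖ ^ 2 + η * a * α / 2 * ‖u t‖ ^ 2 := by
      refine (mul_le_mul_of_nonneg_left (real_inner_le_norm _ _) hη0.le).trans ?_
      have : η / (2 * a * α) * ‖g t‖ ^ 2 + η * a * α / 2 * ‖u t‖ ^ 2 - η * (‖g t‖ * ‖u t‖)
          = η / (2 * a * α) * (‖g t‖ - a * α * ‖u t‖) ^ 2 := by field_simp; ring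
      have h0 : 0 ≤ η / (2 * a * α) * (‖g t‖ - a * α * ‖u t‖) ^ 2 := by positivity
      linarith
    have f3 := mul_le_mul_of_nonneg_left (hA (v t)) hb.le
    have f4 := mul_le_mul_of_nonneg_left (hA (u t)) (show 0 ≤ η * a by positivity)
    have f5 := mul_le_mul_of_nonneg_left (hKκ (v t)) hη0.le
    have f6 := mul_le_mul_of_nonneg_right hN3 (sq_nonneg ‖g t‖)
    have f7 := mul_le_mul_of_nonneg_right hm3 (sq_nonneg ‖v t‖)
    have f8 := mul_le_mul_of_nonneg_right hm4 (sq_nonneg ‖u t‖)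
    have f9 : η * (κ * ‖v t‖ ^ 2) = b * α / 2 * ‖v t‖ ^ 2 := by rw [← hηκ]; ring
    rw [e5]
    linarith

end Energy

theorem norm_sq_toLp {α F : Type*} [MeasurableSpace α] {μ : Measure α} [NormedAddCommGroup F]
    [InnerProductSpace ℝ F] {g : α → F} (hg : MemLp g 2 μ) :
    ‖hg.toLp g‖ ^ 2 = ∫ x, ‖g x‖ ^ 2 ∂μ := by
  rw [norm_sq_Lp_two]
  refine integral_congr_ae ?_
  filter_upwards [hg.coeFn_toLp] with x hx
  rw [hx]

theorem norm_apply_sq_le {X Y : Type*} [NormedAddCommGroup X] [NormedSpace ℝ X]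
    [NormedAddCommGroup Y] [NormedSpace ℝ Y] (j : X →L[ℝ] Y) (x : X) :
    ‖j x‖ ^ 2 ≤ ‖j‖ ^ 2 * ‖x‖ ^ 2 := by
  rw [← mul_pow]
  exact pow_le_pow_left₀ (norm_nonneg _) (j.le_opNorm x) 2

/-! ### Classical solutions of the singular equation with nearby data. -/

section Approximation

variable {V H : Type} [NormedAddCommGroup V] [InnerProductSpace ℝ V] [CompleteSpace V]
  [NormedAddCommGroup H] [InnerProductSpace ℝ H] [CompleteSpace H]

/-- The form `(j x, j y)` on `V` as an operator. -/
def massOp (j : V →L[ℝ] H) : V →L[ℝ] V := j.adjoint.comp j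

theorem inner_massOp_left (j : V →L[ℝ] H) (x y : V) :
    inner ℝ (massOp j x) y = inner ℝ (j x) (j y) :=
  j.adjoint_inner_left y (j x)

theorem inner_massOp_right (j : V →L[ℝ] H) (x y : V) :
    inner ℝ x (massOp j y) = inner ℝ (j x) (j y) :=
  j.adjoint_inner_right x (j y)

/-- Pair the equation with w = u''. Since the source is j† f, the product (f, jw) is absorbed by
‖jw‖², at the cost of ‖f‖²/4. The term b(Av, w) is a derivative, a(Au, w) is one up to -a(Av, v),
and completing the square bounds the boundary term at T from below. The right-hand side does not
contain δ. -/
theorem IsClassicalSolution.integral_second_deriv_le {j : V →L[ℝ] H} {A : V →L[ℝ] V}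
    {a b δ : ℝ} (hb : 0 < b) (hAs : ∀ x y, inner ℝ (A x) y = inner ℝ x (A y))
    (hA : ∀ x, 0 ≤ inner ℝ (A x) x) {u v w : ℝ → V} {f : ℝ → H} (hf : Continuous f)
    (h : IsClassicalSolution (massOp j + δ • ContinuousLinearMap.id ℝ V) A a b u v w
      (fun t => j.adjoint (f t))) {T : ℝ} (hT : 0 ≤ T) :
    δ * ∫ t in (0 : ℝ)..T, ‖w t‖ ^ 2 ≤ b / 2 * inner ℝ (A (v 0)) (v 0)
      + a * inner ℝ (A (u 0)) (v 0) + a ^ 2 / (2 * b) * inner ℝ (A (u T)) (u T)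
      + ∫ t in (0 : ℝ)..T, (a * inner ℝ (A (v t)) (v t) + 1 / 4 * ‖f t‖ ^ 2) := by
  have hcu := h.continuous_fst
  have hcv := h.continuous_snd
  have hcw := h.continuous
  have hΦ : ∀ t, HasDerivAt
      (fun t => b / 2 * inner ℝ (A (v t)) (v t) + a * inner ℝ (A (u t)) (v t))
      (b / 2 * (inner ℝ (A (v t)) (w t) + inner ℝ (A (w t)) (v t))
        + a * (inner ℝ (A (u t)) (w t) + inner ℝ (A (v t)) (v t))) t := by
    intro t
    have hu := h.hasDerivAt t
    have hv := h.hasDerivAt' t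
    have hAv := A.hasFDerivAt.comp_hasDerivAt t hv
    have hAu := A.hasFDerivAt.comp_hasDerivAt t hu
    exact ((hAv.inner ℝ hv).const_mul _).add ((hAu.inner ℝ hv).const_mul _)
  have key := add_integral_le_of_deriv_add_le hΦ (D := fun t => δ * ‖w t‖ ^ 2)
    (G := fun t => a * inner ℝ (A (v t)) (v t) + 1 / 4 * ‖f t‖ ^ 2)
    (by fun_prop) (by fun_prop) (by fun_prop) (fun t => ?_) hT
  · rw [intervalIntegral.integral_const_mul] at key
    have h1 := hA (v T + (a / b) • u T)
    simp only [map_add, map_smul, inner_add_left, inner_add_right, real_inner_smul_left,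
      real_inner_smul_right] at h1
    rw [hAs (v T) (u T), real_inner_comm (A (u T)) (v T)] at h1
    have h2 := mul_nonneg (show 0 ≤ b / 2 by positivity) h1
    have h3 : b / 2 * (inner ℝ (A (v T)) (v T) + a / b * inner ℝ (A (u T)) (v T)
        + a / b * (inner ℝ (A (u T)) (v T) + a / b * inner ℝ (A (u T)) (u T)))
        = b / 2 * inner ℝ (A (v T)) (v T) + a * inner ℝ (A (u T)) (v T)
        + a ^ 2 / (2 * b) * inner ℝ (A (u T)) (u T) := by field_simp; ring
    linarith
  · have e := congrArg (fun y => inner ℝ y (w t)) (h.equation t)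
    simp only [add_apply, smul_apply, inner_add_left, real_inner_smul_left,
      inner_massOp_left, ContinuousLinearMap.adjoint_inner_left, ContinuousLinearMap.coe_id',
      id, real_inner_self_eq_norm_sq] at e
    have e1 : inner ℝ (A (w t)) (v t) = inner ℝ (A (v t)) (w t) := by
      rw [hAs, real_inner_comm]
    have e2 := real_inner_le_norm (f t) (j (w t))
    rw [e1]
    nlinarith [sq_nonneg (‖j (w t)‖ - 1 / 2 * ‖f t‖)]

/-- The regularised equation is solved for small δ, and the term δw is then counted as an error in
the source. The ODE needs a continuous source and an initial velocity in V, so f is approximated by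
a continuous F and u₁ by an element of the dense range of j. -/
theorem exists_isClassicalSolution_near {j : V →L[ℝ] H} (hj : DenseRange j) (A : V →L[ℝ] V)
    {a b α : ℝ} (ha : 0 < a) (hb : 0 < b) (hα : 0 < α)
    (hAs : ∀ x y, inner ℝ (A x) y = inner ℝ x (A y))
    (hA : ∀ x, α * ‖x‖ ^ 2 ≤ inner ℝ (A x) x) (u₀ : V) (u₁ : H) (f : L2Time H) {e : ℝ}
    (he : 0 < e) :
    ∃ u v w g : ℝ → V, IsClassicalSolution (massOp j) A a b u v w g ∧ u 0 = u₀ ∧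
      ‖j (v 0) - u₁‖ ≤ e ∧
      ∃ hg : MemLp g 2 timeMeasure, ‖hg.toLp g - j.adjoint.compLp f‖ ≤ e := by
  obtain ⟨v₀, hv₀⟩ := hj.exists_dist_lt u₁ he
  obtain ⟨e₁, he₁, hje₁⟩ : ∃ e₁ : ℝ, 0 < e₁ ∧ ‖j.adjoint‖ * e₁ ≤ e / 2 := by
    refine ⟨e / 2 / (‖j.adjoint‖ + 1), by positivity, ?_⟩
    rw [mul_div_assoc', div_le_iff₀ (by positivity)]
    nlinarith [norm_nonneg j.adjoint]
  obtain ⟨F, -, hF, hFc, hFm⟩ := (Lp.memLp f).exists_hasCompactSupport_eLpNorm_sub_le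
    (by norm_num) (ε := ENNReal.ofReal e₁) (by simpa using he₁)
  have hFf : ‖hFm.toLp F - f‖ ≤ e₁ := by
    rw [norm_sub_rev]
    conv_lhs => rw [← Lp.toLp_coeFn f (Lp.memLp f)]
    rw [← MemLp.toLp_sub, Lp.norm_toLp]
    exact ENNReal.toReal_le_of_le_ofReal he₁.le hF
  have hA0 : ∀ x, 0 ≤ inner ℝ (A x) x := fun x => le_trans (by positivity) (hA x)
  have hAle : ∀ x, inner ℝ (A x) x ≤ ‖A‖ * ‖x‖ ^ 2 := by
    intro x
    refine (real_inner_le_norm _ _).trans ?_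
    rw [pow_two, ← mul_assoc]
    exact mul_le_mul_of_nonneg_right (A.le_opNorm _) (norm_nonneg _)
  obtain ⟨C, hC, henergy⟩ := exists_energy_le A (κ := ‖j‖ ^ 2 + 1) ha hb hα (by positivity) hAs hA
  have hFi : Integrable (fun t => ‖F t‖ ^ 2) timeMeasure :=
    (memLp_two_iff_integrable_sq_norm hFm.1).1 hFm
  -- I will bound the energy, and J will bound δ∫‖w‖². Both are fixed before δ: the bound κ = ‖j‖² +
  -- 1 serves every δ ≤ 1.
  obtain ⟨I, hI⟩ : ∃ I, I = C * (‖u₀‖ ^ 2 + (‖j‖ ^ 2 + 1) * ‖v₀‖ ^ 2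
    + ‖j.adjoint‖ ^ 2 * ∫ t, ‖F t‖ ^ 2 ∂timeMeasure) := ⟨_, rfl⟩
  obtain ⟨J, hJ⟩ : ∃ J, J = b / 2 * inner ℝ (A v₀) v₀ + a * inner ℝ (A u₀) v₀
    + a ^ 2 / (2 * b) * (‖A‖ * I) + (a * ‖A‖ * I + 1 / 4 * ∫ t, ‖F t‖ ^ 2 ∂timeMeasure) :=
    ⟨_, rfl⟩
  -- From δ∫‖w‖² ≤ J follows ‖δw‖² ≤ δJ, hence the smallness required of δJ.
  obtain ⟨δ, hδ, hδ1, hδJ⟩ : ∃ δ : ℝ, 0 < δ ∧ δ ≤ 1 ∧ δ * J ≤ (e / 2) ^ 2 := by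
    refine ⟨min 1 ((e / 2) ^ 2 / (|J| + 1)), by positivity, min_le_left _ _, ?_⟩
    have h0 : 0 ≤ min 1 ((e / 2) ^ 2 / (|J| + 1)) := by positivity
    calc min 1 ((e / 2) ^ 2 / (|J| + 1)) * J
        ≤ min 1 ((e / 2) ^ 2 / (|J| + 1)) * (|J| + 1) :=
          mul_le_mul_of_nonneg_left ((le_abs_self J).trans (by linarith)) h0
      _ ≤ (e / 2) ^ 2 / (|J| + 1) * (|J| + 1) :=
          mul_le_mul_of_nonneg_right (min_le_right _ _) (by positivity)
      _ = (e / 2) ^ 2 := div_mul_cancel₀ _ (by positivity)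
  let K : V →L[ℝ] V := massOp j + δ • ContinuousLinearMap.id ℝ V
  have hKx : ∀ x y, inner ℝ (K x) y = inner ℝ (j x) (j y) + δ * inner ℝ x y := fun x y => by
    simp [K, inner_add_left, inner_massOp_left, real_inner_smul_left]
  have hKxx : ∀ x, inner ℝ (K x) x = ‖j x‖ ^ 2 + δ * ‖x‖ ^ 2 := fun x => by
    rw [hKx, real_inner_self_eq_norm_sq, real_inner_self_eq_norm_sq]
  have hKκ : ∀ x, inner ℝ (K x) x ≤ (‖j‖ ^ 2 + 1) * ‖x‖ ^ 2 := fun x => by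
    rw [hKxx]
    nlinarith [norm_apply_sq_le j x, sq_nonneg ‖x‖]
  obtain ⟨u, v, w, h, hu0, hv0⟩ := exists_isClassicalSolution (K := K) A a b hδ
    (fun x => by rw [hKxx]; nlinarith [sq_nonneg ‖j x‖])
    (g := fun t => j.adjoint (F t)) (by fun_prop) u₀ v₀
  have hcu := h.continuous_fst
  have hcv := h.continuous_snd
  have hcw := h.continuous
  have hFT : ∀ T, 0 ≤ T →
      ∫ t in (0 : ℝ)..T, ‖F t‖ ^ 2 ≤ ∫ t, ‖F t‖ ^ 2 ∂timeMeasure := fun T hT =>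
    intervalIntegral_le_integral_timeMeasure hFi (fun t => by positivity) hT
  have hest : ∀ T, 0 ≤ T → ‖u T‖ ^ 2 + ∫ t in (0 : ℝ)..T, (‖u t‖ ^ 2 + ‖v t‖ ^ 2) ≤ I := by
    intro T hT
    have h1 := henergy K
      (fun x y => by rw [hKx, real_inner_comm (K y) x, hKx, real_inner_comm (j x), real_inner_comm x])
      (fun x => by rw [hKxx]; positivity) hKκ u v w _ h T hT
    have h2 : 0 ≤ inner ℝ (K (v T)) (v T) := by rw [hKxx]; positivity
    have h3 : ∫ t in (0 : ℝ)..T, ‖j.adjoint (F t)‖ ^ 2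
        ≤ ‖j.adjoint‖ ^ 2 * ∫ t, ‖F t‖ ^ 2 ∂timeMeasure := by
      refine le_trans ?_ (mul_le_mul_of_nonneg_left (hFT T hT) (by positivity))
      rw [← intervalIntegral.integral_const_mul]
      refine intervalIntegral.integral_mono hT ?_ ?_ fun t => norm_apply_sq_le _ _
      · exact Continuous.intervalIntegrable (by fun_prop) _ _
      · exact Continuous.intervalIntegrable (by fun_prop) _ _
    have h4 : C * (‖u 0‖ ^ 2 + inner ℝ (K (v 0)) (v 0)
        + ∫ t in (0 : ℝ)..T, ‖j.adjoint (F t)‖ ^ 2) ≤ I := by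
      rw [hI, hu0, hv0]
      have := hKκ v₀
      gcongr
    linarith
  have hint0 : ∀ T, 0 ≤ T → 0 ≤ ∫ t in (0 : ℝ)..T, (‖u t‖ ^ 2 + ‖v t‖ ^ 2) := fun T hT =>
    intervalIntegral.integral_nonneg hT fun t _ => by positivity
  have hwT : ∀ T, 0 ≤ T → ∫ t in (0 : ℝ)..T, ‖w t‖ ^ 2 ≤ J / δ := by
    intro T hT
    rw [le_div_iff₀ hδ, mul_comm]
    refine (h.integral_second_deriv_le hb hAs hA0 hFc hT).trans ?_
    rw [hu0, hv0, hJ]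
    have h1 : inner ℝ (A (u T)) (u T) ≤ ‖A‖ * I := (hAle _).trans
      (mul_le_mul_of_nonneg_left (by linarith [hest T hT, hint0 T hT]) (norm_nonneg _))
    have h2 : ∫ t in (0 : ℝ)..T, (a * inner ℝ (A (v t)) (v t) + 1 / 4 * ‖F t‖ ^ 2)
        ≤ ∫ t in (0 : ℝ)..T, (a * ‖A‖ * (‖u t‖ ^ 2 + ‖v t‖ ^ 2) + 1 / 4 * ‖F t‖ ^ 2) := by
      refine intervalIntegral.integral_mono hT ?_ ?_ fun t => ?_
      · exact Continuous.intervalIntegrable (by fun_prop) _ _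
      · exact Continuous.intervalIntegrable (by fun_prop) _ _
      · have h3 := mul_le_mul_of_nonneg_left (hAle (v t)) ha.le
        have h4 : 0 ≤ a * ‖A‖ * ‖u t‖ ^ 2 := by positivity
        simp only
        linarith
    have h6 : ∫ t in (0 : ℝ)..T, (a * ‖A‖ * (‖u t‖ ^ 2 + ‖v t‖ ^ 2) + 1 / 4 * ‖F t‖ ^ 2)
        = a * ‖A‖ * (∫ t in (0 : ℝ)..T, (‖u t‖ ^ 2 + ‖v t‖ ^ 2))
          + 1 / 4 * ∫ t in (0 : ℝ)..T, ‖F t‖ ^ 2 := by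
      rw [intervalIntegral.integral_add, intervalIntegral.integral_const_mul,
        intervalIntegral.integral_const_mul]
      · exact Continuous.intervalIntegrable (by fun_prop) _ _
      · exact Continuous.intervalIntegrable (by fun_prop) _ _
    have h3 : ∫ t in (0 : ℝ)..T, (‖u t‖ ^ 2 + ‖v t‖ ^ 2) ≤ I := by
      linarith [hest T hT, sq_nonneg ‖u T‖]
    have h4 := mul_le_mul_of_nonneg_left h3 (show 0 ≤ a * ‖A‖ by positivity)
    have h5 := mul_le_mul_of_nonneg_left h1 (show 0 ≤ a ^ 2 / (2 * b) by positivity)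
    linarith [hFT T hT]
  obtain ⟨hwi, hwI⟩ := integrable_timeMeasure_of_forall_integral_le
    (q := fun t => ‖w t‖ ^ 2) (by fun_prop) (fun t => by positivity) hwT
  have hwm : MemLp w 2 timeMeasure :=
    (memLp_two_iff_integrable_sq_norm hcw.aestronglyMeasurable).2 hwi
  have hjF : MemLp (fun t => j.adjoint (F t)) 2 timeMeasure := j.adjoint.comp_memLp' hFm
  -- Moving δw to the right restores `massOp j` exactly.
  refine ⟨u, v, w, fun t => j.adjoint (F t) - δ • w t,
    ⟨h.hasDerivAt, h.hasDerivAt', hcw, fun t => ?_⟩, hu0, ?_, hjF.sub (hwm.const_smul δ), ?_⟩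
  · rw [← h.equation]
    simp only [K, add_apply, smul_apply, ContinuousLinearMap.coe_id', id]
    abel
  · rw [hv0, ← dist_eq_norm, dist_comm]
    exact hv₀.le
  · have h1 : (hjF.sub (hwm.const_smul δ)).toLp _ - j.adjoint.compLp f
        = j.adjoint.compLp (hFm.toLp F - f) - δ • hwm.toLp w := by
      have e1 : hjF.toLp _ = j.adjoint.compLp (hFm.toLp F) := by
        refine Lp.ext ?_
        filter_upwards [hjF.coeFn_toLp, hFm.coeFn_toLp,
          j.adjoint.coeFn_compLp (hFm.toLp F)] with t h1 h2 h3
        rw [h1, h3, h2]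
      have e2 : j.adjoint.compLp (hFm.toLp F - f)
          = j.adjoint.compLp (hFm.toLp F) - j.adjoint.compLp f :=
        map_sub (j.adjoint.compLpL 2 timeMeasure) _ _
      rw [MemLp.toLp_sub hjF (hwm.const_smul δ), MemLp.toLp_const_smul δ hwm, e1, e2]
      exact sub_right_comm _ _ _
    have h2 : ‖δ • hwm.toLp w‖ ≤ e / 2 := by
      refine abs_le_of_sq_le_sq' ?_ (by positivity) |>.2
      rw [norm_smul, mul_pow, norm_sq_toLp, Real.norm_eq_abs, sq_abs]
      refine le_trans ?_ hδJ
      calc δ ^ 2 * ∫ t, ‖w t‖ ^ 2 ∂timeMeasure ≤ δ ^ 2 * (J / δ) := by gcongr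
        _ = δ * J := by field_simp
    have h3 : ‖j.adjoint.compLp (hFm.toLp F - f)‖ ≤ e / 2 :=
      (j.adjoint.norm_compLp_le _).trans
        ((mul_le_mul_of_nonneg_left hFf (norm_nonneg _)).trans hje₁)
    change ‖(hjF.sub (hwm.const_smul δ)).toLp _ - _‖ ≤ e
    rw [h1]
    exact (norm_sub_le _ _).trans (by linarith)

end Approximation

/-! ### Weak time derivatives and initial values, and their stability under limits. -/

section TimeDerivative

variable {X : Type} [NormedAddCommGroup X] [NormedSpace ℝ X]

theorem IsTest.integral_smul_timeMeasure {φ : ℝ → ℝ} (hφ : IsTest (Ioi 0) φ) (u : ℝ → X) :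
    ∫ t, φ t • u t ∂timeMeasure = ∫ t, φ t • u t := by
  refine setIntegral_eq_integral_of_forall_compl_eq_zero fun t ht => ?_
  rw [image_eq_zero_of_notMem_tsupport fun h => ht (Ioi_subset_Ici_self (hφ.supp h)), zero_smul]

theorem IsTest.deriv {φ : ℝ → ℝ} {U : Set ℝ} (hφ : IsTest U φ) : IsTest U (deriv φ) where
  smooth := ContDiff.deriv' hφ.smooth
  compact := hφ.compact.deriv
  supp := tsupport_deriv_subset.trans hφ.supp

theorem isWeakTimeDeriv_of_hasDerivAt {u w : ℝ → X}
    (hu : ∀ t, HasDerivAt u (w t) t) (hw : Continuous w) : IsWeakTimeDeriv u w := by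
  intro φ hφ
  rw [hφ.integral_smul_timeMeasure, hφ.deriv.integral_smul_timeMeasure]
  have huc : Continuous u := continuous_iff_continuousAt.2 fun t => (hu t).continuousAt
  have hφc := hφ.smooth.continuous
  have hφd : ∀ t, HasDerivAt φ (_root_.deriv φ t) t := fun t =>
    ((hφ.smooth.differentiable (by simp)) t).hasDerivAt
  have key := integral_bilinear_hasDerivAt_right_eq_neg_left_of_integrable
    (L := ContinuousLinearMap.lsmul ℝ ℝ) (u := φ) (v := u)
    (fun t _ => hφd t) (fun t _ => hu t)
    ((hφc.smul hw).integrable_of_hasCompactSupport hφ.compact.smul_right)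
    ((hφ.deriv.smooth.continuous.smul huc).integrable_of_hasCompactSupport
      hφ.deriv.compact.smul_right)
    ((hφc.smul huc).integrable_of_hasCompactSupport hφ.compact.smul_right)
  simp only [ContinuousLinearMap.lsmul_apply] at key
  rw [key, neg_neg]

theorem IsWeakTimeDeriv.congr {u w u' w' : ℝ → X} (h : IsWeakTimeDeriv u w)
    (hu : u =ᵐ[timeMeasure] u') (hw : w =ᵐ[timeMeasure] w') : IsWeakTimeDeriv u' w' := by
  intro φ hφ
  have h1 : ∫ t, deriv φ t • u t ∂timeMeasure = ∫ t, deriv φ t • u' t ∂timeMeasure :=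
    integral_congr_ae (hu.mono fun t ht => congrArg (deriv φ t • ·) ht)
  have h2 : ∫ t, φ t • w t ∂timeMeasure = ∫ t, φ t • w' t ∂timeMeasure :=
    integral_congr_ae (hw.mono fun t ht => congrArg (φ t • ·) ht)
  rw [← h1, ← h2]
  exact h φ hφ

theorem HasInitialValue.congr {X : Type} [NormedAddCommGroup X] {u v : ℝ → X} {a : X}
    (h : HasInitialValue u a) (huv : u =ᵐ[timeMeasure] v) : HasInitialValue v a := by
  obtain ⟨u', h1, h2, h3⟩ := h
  exact ⟨u', h1, h2.trans huv, h3⟩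

theorem IsTest.integrable_smul {φ : ℝ → ℝ} {U : Set ℝ} (hφ : IsTest U φ) {u : ℝ → X}
    (hu : MemLp u 2 timeMeasure) : Integrable (fun t => φ t • u t) timeMeasure :=
  memLp_one_iff_integrable.1
    (hu.smul (hφ.smooth.continuous.memLp_of_hasCompactSupport hφ.compact : MemLp φ 2 timeMeasure)
      (r := 1))

theorem IsWeakTimeDeriv.clm_comp [CompleteSpace X] {Y : Type} [NormedAddCommGroup Y]
    [NormedSpace ℝ Y] [CompleteSpace Y]
    (B : X →L[ℝ] Y) {u w : ℝ → X} (h : IsWeakTimeDeriv u w) (hu : MemLp u 2 timeMeasure)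
    (hw : MemLp w 2 timeMeasure) : IsWeakTimeDeriv (fun t => B (u t)) (fun t => B (w t)) := by
  intro φ hφ
  have := congrArg B (h φ hφ)
  rw [map_neg, ← B.integral_comp_comm (hφ.deriv.integrable_smul hu),
    ← B.integral_comp_comm (hφ.integrable_smul hw)] at this
  simpa only [map_smul] using this

theorem HasInitialValue.clm_comp {Y : Type} [NormedAddCommGroup Y] [NormedSpace ℝ Y]
    (B : X →L[ℝ] Y) {u : ℝ → X} {a : X} (h : HasInitialValue u a) :
    HasInitialValue (fun t => B (u t)) (B a) := by
  obtain ⟨u', h1, h2, h3⟩ := h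
  exact ⟨fun t => B (u' t), B.continuous.comp_continuousOn h1, h2.mono fun t ht => congrArg B ht,
    congrArg B h3⟩

theorem tendsto_integral_smul [CompleteSpace X] {φ : ℝ → ℝ} {U : Set ℝ} (hφ : IsTest U φ)
    {u : ℕ → L2Time X} {u' : L2Time X} (hu : Tendsto u atTop (𝓝 u')) :
    Tendsto (fun k => ∫ t, φ t • u k t ∂timeMeasure) atTop
      (𝓝 (∫ t, φ t • u' t ∂timeMeasure)) := by
  have hm : MemLp φ 2 timeMeasure := hφ.smooth.continuous.memLp_of_hasCompactSupport hφ.compact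
  let P := (ContinuousLinearMap.lpPairing timeMeasure 2 2
    (ContinuousLinearMap.lsmul ℝ ℝ (E := X))) (hm.toLp φ)
  have hP : ∀ v : L2Time X, P v = ∫ t, φ t • v t ∂timeMeasure := by
    intro v
    simp only [P]
    rw [ContinuousLinearMap.lpPairing_eq_integral]
    refine integral_congr_ae ?_
    filter_upwards [hm.coeFn_toLp] with t ht
    rw [ht, ContinuousLinearMap.lsmul_apply]
  simp_rw [← hP]
  exact (P.continuous.tendsto u').comp hu

theorem isWeakTimeDeriv_of_tendsto [CompleteSpace X] {u w : ℕ → L2Time X} {u' w' : L2Time X}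
    (hu : Tendsto u atTop (𝓝 u')) (hw : Tendsto w atTop (𝓝 w'))
    (h : ∀ k, IsWeakTimeDeriv (u k) (w k)) : IsWeakTimeDeriv u' w' := by
  intro φ hφ
  refine tendsto_nhds_unique (tendsto_integral_smul hφ.deriv hu) ?_
  simp_rw [fun k => h k φ hφ]
  exact (tendsto_integral_smul hφ hw).neg

/-- The uniform limit is continuous with the right value at 0; it agrees a.e. with the L² limit
because a subsequence of the latter converges a.e. -/
theorem hasInitialValue_of_tendsto {X : Type} [NormedAddCommGroup X] [CompleteSpace X]
    {u : ℕ → ℝ → X} {U : ℕ → L2Time X} {U' : L2Time X} {a : X}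
    (hc : ∀ k, Continuous (u k)) (hu : UniformCauchySeqOn u atTop (Ici 0))
    (hU : ∀ k, U k =ᵐ[timeMeasure] u k) (hU' : Tendsto U atTop (𝓝 U'))
    (ha : Tendsto (fun k => u k 0) atTop (𝓝 a)) : HasInitialValue U' a := by
  have hlim : ∀ t ∈ Ici (0 : ℝ), ∃ x, Tendsto (fun k => u k t) atTop (𝓝 x) := fun t ht =>
    cauchySeq_tendsto_of_complete (hu.cauchySeq ht)
  choose! v hv using hlim
  refine ⟨v, ?_, ?_, tendsto_nhds_unique (hv 0 self_mem_Ici) ha⟩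
  · exact (hu.tendstoUniformlyOn_of_tendsto hv).continuousOn
      (Frequently.of_forall fun k => (hc k).continuousOn)
  · obtain ⟨ns, hns, hae⟩ := (tendstoInMeasure_of_tendsto_Lp hU').exists_seq_tendsto_ae
    filter_upwards [hae, ae_all_iff.2 hU, ae_restrict_mem measurableSet_Ici] with t h1 h2 h3
    refine tendsto_nhds_unique ((hv t h3).comp hns.tendsto_atTop) (h1.congr fun k => ?_)
    exact h2 _

end TimeDerivative

/-! ### Existence by passage to the limit. -/

section Existence

variable {V H : Type} [NormedAddCommGroup V] [InnerProductSpace ℝ V] [CompleteSpace V]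
  [NormedAddCommGroup H] [InnerProductSpace ℝ H] [CompleteSpace H]

/-- The energy estimate requires only K ≥ 0, so it holds for the degenerate `massOp j`. A single
radius R gives the pointwise bounds needed for continuity and the L² bounds needed for completeness.
-/
theorem exists_energy_timeMeasure_le (j : V →L[ℝ] H) (A : V →L[ℝ] V) {a b α : ℝ} (ha : 0 < a)
    (hb : 0 < b) (hα : 0 < α) (hAs : ∀ x y, inner ℝ (A x) y = inner ℝ x (A y))
    (hA : ∀ x, α * ‖x‖ ^ 2 ≤ inner ℝ (A x) x) :
    ∃ C : ℝ, 0 < C ∧ ∀ u v w g : ℝ → V, IsClassicalSolution (massOp j) A a b u v w g →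
      ∀ hg : MemLp g 2 timeMeasure, ∀ R : ℝ,
        C * (‖u 0‖ ^ 2 + ‖j (v 0)‖ ^ 2 + ‖hg.toLp g‖ ^ 2) ≤ R ^ 2 → 0 ≤ R →
          (∀ t, 0 ≤ t → ‖u t‖ ≤ R ∧ ‖j (v t)‖ ≤ R) ∧
          ∃ (hu : MemLp u 2 timeMeasure) (hv : MemLp v 2 timeMeasure),
            ‖hu.toLp u‖ ≤ R ∧ ‖hv.toLp v‖ ≤ R := by
  obtain ⟨C, hC, h⟩ := exists_energy_le A (κ := ‖j‖ ^ 2 + 1) ha hb hα (by positivity) hAs hA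
  have hKxx : ∀ x, inner ℝ (massOp j x) x = ‖j x‖ ^ 2 := fun x => by
    rw [inner_massOp_left, real_inner_self_eq_norm_sq]
  refine ⟨C, hC, fun u v w g hs hg R hR hR0 => ?_⟩
  have hcu := hs.continuous_fst
  have hcv := hs.continuous_snd
  have hgi : Integrable (fun t => ‖g t‖ ^ 2) timeMeasure :=
    (memLp_two_iff_integrable_sq_norm hg.1).1 hg
  have hest : ∀ T, 0 ≤ T →
      ‖j (v T)‖ ^ 2 + ‖u T‖ ^ 2 + ∫ t in (0 : ℝ)..T, (‖u t‖ ^ 2 + ‖v t‖ ^ 2) ≤ R ^ 2 := by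
    intro T hT
    have h1 := h (massOp j) (fun x y => by rw [inner_massOp_left, inner_massOp_right])
      (fun x => by rw [hKxx]; positivity)
      (fun x => by rw [hKxx]; nlinarith [norm_apply_sq_le j x, sq_nonneg ‖x‖]) u v w g hs T hT
    rw [hKxx, hKxx] at h1
    refine h1.trans (le_trans ?_ hR)
    rw [norm_sq_toLp]
    have := intervalIntegral_le_integral_timeMeasure hgi (fun t => by positivity) hT
    gcongr
  have hint0 : ∀ T, 0 ≤ T → 0 ≤ ∫ t in (0 : ℝ)..T, (‖u t‖ ^ 2 + ‖v t‖ ^ 2) := fun T hT =>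
    intervalIntegral.integral_nonneg hT fun t _ => by positivity
  have hmem : ∀ z : ℝ → V, Continuous z → (∀ t, ‖z t‖ ^ 2 ≤ ‖u t‖ ^ 2 + ‖v t‖ ^ 2) →
      ∃ hz : MemLp z 2 timeMeasure, ‖hz.toLp z‖ ≤ R := by
    intro z hz hle
    obtain ⟨h1, h2⟩ := integrable_timeMeasure_of_forall_integral_le
      (q := fun t => ‖z t‖ ^ 2) (I := R ^ 2) (by fun_prop) (fun t => by positivity) fun T hT => by
        have h1 : ∫ t in (0 : ℝ)..T, ‖z t‖ ^ 2 ≤ ∫ t in (0 : ℝ)..T, (‖u t‖ ^ 2 + ‖v t‖ ^ 2) :=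
          intervalIntegral.integral_mono hT (Continuous.intervalIntegrable (by fun_prop) _ _)
            (Continuous.intervalIntegrable (by fun_prop) _ _) hle
        linarith [hest T hT, sq_nonneg ‖u T‖, sq_nonneg ‖j (v T)‖]
    have hzm := (memLp_two_iff_integrable_sq_norm hz.aestronglyMeasurable).2 h1
    refine ⟨hzm, abs_le_of_sq_le_sq' ?_ hR0 |>.2⟩
    rwa [norm_sq_toLp]
  refine ⟨fun t ht => ⟨abs_le_of_sq_le_sq' ?_ hR0 |>.2, abs_le_of_sq_le_sq' ?_ hR0 |>.2⟩, ?_⟩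
  · linarith [hest t ht, hint0 t ht, sq_nonneg ‖j (v t)‖]
  · linarith [hest t ht, hint0 t ht, sq_nonneg ‖u t‖]
  · obtain ⟨hu, hu'⟩ := hmem u hcu fun t => le_add_of_nonneg_right (by positivity)
    obtain ⟨hv, hv'⟩ := hmem v hcv fun t => le_add_of_nonneg_left (by positivity)
    exact ⟨hu, hv, hu', hv'⟩

/-- Existence for `K u'' + b A u' + a A u = j† f`, where `K = j† j`. -/
theorem exists_weakSolution {j : V →L[ℝ] H} (hj : DenseRange j) (A : V →L[ℝ] V)
    {a b α : ℝ} (ha : 0 < a) (hb : 0 < b) (hα : 0 < α)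
    (hAs : ∀ x y, inner ℝ (A x) y = inner ℝ x (A y))
    (hA : ∀ x, α * ‖x‖ ^ 2 ≤ inner ℝ (A x) x) (u₀ : V) (u₁ : H) (f : L2Time H) :
    ∃ u v : L2Time V, IsWeakTimeDeriv u v ∧ HasInitialValue u u₀ ∧
      HasInitialValue (fun t => j (v t)) u₁ ∧
      IsWeakTimeDeriv (fun t => massOp j (v t))
        (j.adjoint.compLp f - b • A.compLp v - a • A.compLp u : L2Time V) := by
  let e : ℕ → ℝ := fun k => 1 / ((k : ℝ) + 1)
  have he0 : ∀ k, 0 < e k := fun k => by positivity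
  have hea : Antitone e := fun k l hkl => by
    have : (k : ℝ) ≤ l := by exact_mod_cast hkl
    simp only [e]
    gcongr
  have het : Tendsto e atTop (𝓝 0) := tendsto_one_div_add_atTop_nhds_zero_nat
  choose u v w g hs hu0 hv0 hg hgf using fun k =>
    exists_isClassicalSolution_near hj A ha hb hα hAs hA u₀ u₁ f (he0 k)
  obtain ⟨C, hC, hen⟩ := exists_energy_timeMeasure_le j A ha hb hα hAs hA
  have hmem : ∀ k, ∃ (_ : MemLp (u k) 2 timeMeasure), MemLp (v k) 2 timeMeasure := by
    intro k
    obtain ⟨-, hu, hv, -⟩ := hen _ _ _ _ (hs k) (hg k)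
      (√(C * (‖u k 0‖ ^ 2 + ‖j (v k 0)‖ ^ 2 + ‖(hg k).toLp (g k)‖ ^ 2)))
      (by rw [Real.sq_sqrt (by positivity)]) (Real.sqrt_nonneg _)
    exact ⟨hu, hv⟩
  choose hu hv using hmem
  -- For a difference of approximations the initial positions cancel, while the velocity and source
  -- errors are at most 2e_N each, so R² = C·2(2e_N)².
  obtain ⟨M, hM⟩ : ∃ M, M = √(2 * C) := ⟨_, rfl⟩
  have hM0 : 0 ≤ M := hM ▸ Real.sqrt_nonneg _
  have hM2 : M ^ 2 = 2 * C := by rw [hM, Real.sq_sqrt (by positivity)]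
  have hdiff : ∀ k l N : ℕ, N ≤ k → N ≤ l →
      (∀ t, 0 ≤ t → ‖u k t - u l t‖ ≤ M * (2 * e N) ∧ ‖j (v k t) - j (v l t)‖ ≤ M * (2 * e N)) ∧
      ‖(hu k).toLp (u k) - (hu l).toLp (u l)‖ ≤ M * (2 * e N) ∧
      ‖(hv k).toLp (v k) - (hv l).toLp (v l)‖ ≤ M * (2 * e N) := by
    intro k l N hk hl
    have hek := hea hk
    have hel := hea hl
    have h1 : ‖j (v k 0 - v l 0)‖ ≤ 2 * e N := by
      rw [map_sub, ← sub_sub_sub_cancel_right _ _ u₁]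
      exact (norm_sub_le _ _).trans (by linarith [hv0 k, hv0 l])
    have h2 : ‖(hg k).toLp (g k) - (hg l).toLp (g l)‖ ≤ 2 * e N := by
      rw [← sub_sub_sub_cancel_right _ _ (j.adjoint.compLp f)]
      exact (norm_sub_le _ _).trans (by linarith [hgf k, hgf l])
    obtain ⟨h3, _, _, h4, h5⟩ := hen _ _ _ _ ((hs k).sub (hs l)) ((hg k).sub (hg l))
      (M * (2 * e N)) (by
        have h3 : ‖MemLp.toLp (fun t => g k t - g l t) ((hg k).sub (hg l))‖ ≤ 2 * e N :=
          (congrArg norm (MemLp.toLp_sub (hg k) (hg l))).trans_le h2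
        have h4 : u k 0 - u l 0 = 0 := by rw [hu0, hu0, sub_self]
        have h5 := pow_le_pow_left₀ (norm_nonneg _) h1 2
        have h6 := pow_le_pow_left₀ (norm_nonneg _) h3 2
        rw [h4, norm_zero, mul_pow, hM2, mul_comm 2 C, mul_assoc]
        exact mul_le_mul_of_nonneg_left (by linarith) hC.le) (by have := he0 N; positivity)
    refine ⟨fun t ht => ?_, ?_, ?_⟩
    · rw [← map_sub]
      exact h3 t ht
    · rw [← MemLp.toLp_sub]
      exact h4
    · rw [← MemLp.toLp_sub]
      exact h5
  have hMt : Tendsto (fun N => M * (2 * e N)) atTop (𝓝 0) := by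
    simpa using (het.const_mul 2).const_mul M
  obtain ⟨U, hU⟩ := cauchySeq_tendsto_of_complete
    (cauchySeq_of_le_tendsto_0 (s := fun k => (hu k).toLp (u k)) _
      (fun k l N hk hl => by rw [dist_eq_norm]; exact (hdiff k l N hk hl).2.1) hMt)
  obtain ⟨W, hW⟩ := cauchySeq_tendsto_of_complete
    (cauchySeq_of_le_tendsto_0 (s := fun k => (hv k).toLp (v k)) _
      (fun k l N hk hl => by rw [dist_eq_norm]; exact (hdiff k l N hk hl).2.2) hMt)
  have hG : Tendsto (fun k => (hg k).toLp (g k)) atTop (𝓝 (j.adjoint.compLp f)) :=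
    tendsto_iff_norm_sub_tendsto_zero.2 (squeeze_zero (fun _ => norm_nonneg _) hgf het)
  have hjW : Tendsto (fun k => j.compLp ((hv k).toLp (v k))) atTop (𝓝 (j.compLp W)) :=
    ((j.compLpL 2 timeMeasure).continuous.tendsto W).comp hW
  have hKW : Tendsto (fun k => (massOp j).compLp ((hv k).toLp (v k))) atTop
      (𝓝 ((massOp j).compLp W)) :=
    (((massOp j).compLpL 2 timeMeasure).continuous.tendsto W).comp hW
  have hAW : Tendsto (fun k => A.compLp ((hv k).toLp (v k))) atTop (𝓝 (A.compLp W)) :=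
    ((A.compLpL 2 timeMeasure).continuous.tendsto W).comp hW
  have hAU : Tendsto (fun k => A.compLp ((hu k).toLp (u k))) atTop (𝓝 (A.compLp U)) :=
    ((A.compLpL 2 timeMeasure).continuous.tendsto U).comp hU
  have hunif : ∀ {X : Type} [NormedAddCommGroup X] (z : ℕ → ℝ → X),
      (∀ k l N : ℕ, N ≤ k → N ≤ l → ∀ t, 0 ≤ t → ‖z k t - z l t‖ ≤ M * (2 * e N)) →
      UniformCauchySeqOn z atTop (Ici 0) := by
    intro X _ z hz
    rw [Metric.uniformCauchySeqOn_iff]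
    intro r hr
    obtain ⟨N, hN⟩ := (hMt.eventually_lt_const hr).exists
    refine ⟨N, fun k hk l hl t ht => ?_⟩
    rw [dist_eq_norm]
    exact (hz k l N hk hl t ht).trans_lt hN
  refine ⟨U, W, ?_, ?_, ?_, ?_⟩
  · exact isWeakTimeDeriv_of_tendsto hU hW fun k =>
      (isWeakTimeDeriv_of_hasDerivAt (hs k).hasDerivAt (hs k).continuous_snd).congr
        (hu k).coeFn_toLp.symm (hv k).coeFn_toLp.symm
  · exact hasInitialValue_of_tendsto (fun k => (hs k).continuous_fst)
      (hunif u fun k l N hk hl t ht => ((hdiff k l N hk hl).1 t ht).1)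
      (fun k => (hu k).coeFn_toLp) hU (by simp_rw [hu0]; exact tendsto_const_nhds)
  · refine HasInitialValue.congr ?_ (j.coeFn_compLp W)
    refine hasInitialValue_of_tendsto (u := fun k t => j (v k t))
      (fun k => j.continuous.comp (hs k).continuous_snd)
      (hunif _ fun k l N hk hl t ht => ((hdiff k l N hk hl).1 t ht).2) (fun k => ?_) hjW
      (tendsto_iff_norm_sub_tendsto_zero.2 (squeeze_zero (fun _ => norm_nonneg _) hv0 het))
    filter_upwards [j.coeFn_compLp ((hv k).toLp (v k)), (hv k).coeFn_toLp] with t h1 h2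
    rw [h1, h2]
  -- No convergence of w is available, but the equation expresses `massOp j` applied to w through g,
  -- Av and Au, all of which converge in L².
  · refine IsWeakTimeDeriv.congr ?_ ((massOp j).coeFn_compLp W) (EventuallyEq.refl _ _)
    refine isWeakTimeDeriv_of_tendsto hKW ((hG.sub (hAW.const_smul b)).sub (hAU.const_smul a))
      fun k => ?_
    refine (isWeakTimeDeriv_of_hasDerivAt (u := fun t => massOp j (v k t))
      (w := fun t => massOp j (w k t))
      (fun t => (massOp j).hasFDerivAt.comp_hasDerivAt t ((hs k).hasDerivAt' t))
      ((massOp j).continuous.comp (hs k).continuous)).congr ?_ ?_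
    · filter_upwards [(massOp j).coeFn_compLp ((hv k).toLp (v k)), (hv k).coeFn_toLp]
        with t h1 h2
      rw [h1, h2]
    · filter_upwards [A.coeFn_compLp ((hv k).toLp (v k)), (hv k).coeFn_toLp,
        A.coeFn_compLp ((hu k).toLp (u k)), (hu k).coeFn_toLp, (hg k).coeFn_toLp,
        Lp.coeFn_sub ((hg k).toLp (g k) - b • A.compLp ((hv k).toLp (v k)))
          (a • A.compLp ((hu k).toLp (u k))),
        Lp.coeFn_sub ((hg k).toLp (g k)) (b • A.compLp ((hv k).toLp (v k))),
        Lp.coeFn_smul b (A.compLp ((hv k).toLp (v k))),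
        Lp.coeFn_smul a (A.compLp ((hu k).toLp (u k)))] with t h1 h2 h3 h4 h5 h6 h7 h8 h9
      rw [h6, Pi.sub_apply, h7, Pi.sub_apply, h8, h9, Pi.smul_apply, Pi.smul_apply, h1, h2, h3,
        h4, h5, ← (hs k).equation]
      abel

end Existence

/-! ### Smooth cutoffs in time. -/

theorem continuous_deriv_smoothTransition : Continuous (deriv Real.smoothTransition) :=
  (Real.smoothTransition.contDiff (n := ⊤)).continuous_deriv (by simp)

theorem hasDerivAt_smoothTransition (x : ℝ) :
    HasDerivAt Real.smoothTransition (deriv Real.smoothTransition x) x :=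
  ((Real.smoothTransition.contDiff (n := ⊤)).differentiable (by simp) x).hasDerivAt

theorem deriv_smoothTransition_eq_zero {x : ℝ} (hx : x ∉ Icc (0 : ℝ) 1) :
    deriv Real.smoothTransition x = 0 := by
  rw [mem_Icc, not_and_or, not_le, not_le] at hx
  rcases hx with hx | hx
  · have : Real.smoothTransition =ᶠ[𝓝 x] fun _ => 0 := by
      filter_upwards [gt_mem_nhds hx] with y hy
      exact Real.smoothTransition.zero_of_nonpos (le_of_lt hy)
    rw [this.deriv_eq, deriv_const]
  · have : Real.smoothTransition =ᶠ[𝓝 x] fun _ => 1 := by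
      filter_upwards [lt_mem_nhds hx] with y hy
      exact Real.smoothTransition.one_of_one_le (le_of_lt hy)
    rw [this.deriv_eq, deriv_const]

theorem exists_abs_deriv_smoothTransition_le :
    ∃ B : ℝ, ∀ x, |deriv Real.smoothTransition x| ≤ B := by
  have hs : HasCompactSupport (deriv Real.smoothTransition) :=
    HasCompactSupport.intro isCompact_Icc fun x hx => deriv_smoothTransition_eq_zero hx
  obtain ⟨B, hB⟩ := hs.exists_bound_of_continuous continuous_deriv_smoothTransition
  exact ⟨B, hB⟩

theorem integral_deriv_smoothTransition_sub_one :
    ∫ t in Ioi (0 : ℝ), deriv Real.smoothTransition (t - 1) = 1 := by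
  have h := integral_Ioi_of_hasDerivAt_of_tendsto' (a := (0 : ℝ)) (m := 1)
    (f := fun t => Real.smoothTransition (t - 1))
    (f' := fun t => deriv Real.smoothTransition (t - 1))
    (fun t _ => (hasDerivAt_smoothTransition (t - 1)).comp_sub_const t 1)
    (Integrable.integrableOn <|
      (continuous_deriv_smoothTransition.comp (continuous_sub_right 1)).integrable_of_hasCompactSupport
        (HasCompactSupport.intro (isCompact_Icc (a := (1 : ℝ)) (b := 2)) fun x hx =>
          deriv_smoothTransition_eq_zero fun h => hx ⟨by linarith [h.1], by linarith [h.2]⟩))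
    (tendsto_const_nhds.congr' (by
      filter_upwards [eventually_ge_atTop 2] with t ht
      rw [Real.smoothTransition.one_of_one_le (by linarith)]))
  rw [h, Real.smoothTransition.zero_of_nonpos (by norm_num), sub_zero]

/-- A smooth cutoff to `[1 / k, k + 1]`, equal to `1` on `[2 / k, k]`. -/
def timeCutoff (k t : ℝ) : ℝ :=
  Real.smoothTransition (k * t - 1) * (1 - Real.smoothTransition (t - k))

theorem abs_timeCutoff_le_one (k t : ℝ) : |timeCutoff k t| ≤ 1 := by
  have h1 := Real.smoothTransition.nonneg (k * t - 1)
  have h2 := Real.smoothTransition.le_one (k * t - 1)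
  have h3 := Real.smoothTransition.nonneg (t - k)
  have h4 := Real.smoothTransition.le_one (t - k)
  rw [timeCutoff, abs_of_nonneg (mul_nonneg h1 (by linarith))]
  nlinarith

theorem continuous_timeCutoff (k : ℝ) : Continuous (timeCutoff k) := by
  have := Real.smoothTransition.continuous
  unfold timeCutoff
  fun_prop

theorem tendsto_timeCutoff {t : ℝ} (ht : 0 < t) :
    Tendsto (fun k : ℕ => timeCutoff k t) atTop (𝓝 1) := by
  refine tendsto_const_nhds.congr' ?_
  filter_upwards [tendsto_natCast_atTop_atTop.eventually_ge_atTop (2 / t),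
    tendsto_natCast_atTop_atTop.eventually_ge_atTop t] with k h1 h2
  rw [div_le_iff₀ ht] at h1
  rw [timeCutoff, Real.smoothTransition.one_of_one_le (by linarith),
    Real.smoothTransition.zero_of_nonpos (by linarith)]
  norm_num

theorem isTest_exp_mul_timeCutoff (s : ℝ) {k : ℝ} (hk : 0 < k) :
    IsTest (Ioi 0) fun t => Real.exp (-s * t) * timeCutoff k t := by
  have hsub : tsupport (fun t => Real.exp (-s * t) * timeCutoff k t) ⊆ Icc (1 / k) (k + 1) := by
    refine closure_minimal (fun t ht => ?_) isClosed_Icc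
    by_contra hn
    refine ht ?_
    rw [mem_Icc, not_and_or, not_le, not_le, lt_div_iff₀ hk] at hn
    rcases hn with hn | hn
    · simp [timeCutoff, Real.smoothTransition.zero_of_nonpos (show k * t - 1 ≤ 0 by linarith)]
    · simp [timeCutoff, Real.smoothTransition.one_of_one_le (show 1 ≤ t - k by linarith)]
  refine ⟨?_, HasCompactSupport.of_support_subset_isCompact isCompact_Icc
    ((subset_tsupport _).trans hsub), hsub.trans fun t ht => ?_⟩
  · have h : ContDiff ℝ ∞ Real.smoothTransition := Real.smoothTransition.contDiff
    unfold timeCutoff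
    exact (Real.contDiff_exp.comp (contDiff_const.mul contDiff_id)).mul
      ((h.comp ((contDiff_const.mul contDiff_id).sub contDiff_const)).mul
        (contDiff_const.sub (h.comp (contDiff_id.sub contDiff_const))))
  · exact lt_of_lt_of_le (by positivity) ht.1

/-- The three terms behave differently as k → ∞: the first gives the factor -s of the Laplace
transform, the second is an approximate Dirac mass at 0, the third escapes to infinity. -/
theorem deriv_exp_mul_timeCutoff (s k t : ℝ) :
    deriv (fun t => Real.exp (-s * t) * timeCutoff k t) t =
      -(s * (Real.exp (-s * t) * timeCutoff k t))
      + (k * (deriv Real.smoothTransition (k * t - 1) *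
          (Real.exp (-s * t) * (1 - Real.smoothTransition (t - k))))
        - Real.exp (-s * t) * (Real.smoothTransition (k * t - 1)
          * deriv Real.smoothTransition (t - k))) := by
  have h1 : HasDerivAt (fun t => Real.exp (-s * t)) (Real.exp (-s * t) * (-s)) t := by
    simpa using ((hasDerivAt_id t).const_mul (-s)).exp
  have h2 : HasDerivAt (fun t => Real.smoothTransition (k * t - 1))
      (deriv Real.smoothTransition (k * t - 1) * k) t :=
    HasDerivAt.comp (h₂ := Real.smoothTransition) t (hasDerivAt_smoothTransition (k * t - 1))
      (((hasDerivAt_const_mul k).sub_const 1))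
  have h3 : HasDerivAt (fun t => Real.smoothTransition (t - k))
      (deriv Real.smoothTransition (t - k)) t :=
    (hasDerivAt_smoothTransition (t - k)).comp_sub_const t k
  have h4 := (h1.mul (h2.mul (h3.const_sub 1))).deriv
  unfold timeCutoff
  refine Eq.trans h4 ?_
  simp only [Pi.mul_apply]
  ring

theorem memLp_exp_neg {s : ℝ} (hs : 0 < s) :
    MemLp (fun t => Real.exp (-s * t)) 2 timeMeasure := by
  have hc : Continuous fun t => Real.exp (-s * t) := by fun_prop
  rw [memLp_two_iff_integrable_sq hc.aestronglyMeasurable]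
  refine (integrableOn_Ici_iff_integrableOn_Ioi (by simp)).2
    ((exp_neg_integrableOn_Ioi 0 (show 0 < 2 * s by positivity)).congr_fun (fun t _ => ?_)
      measurableSet_Ioi)
  simp only
  rw [← Real.exp_nat_mul]
  congr 1
  push_cast
  ring

/-! ### The Laplace transform of vector-valued L² functions. -/

section Laplace

variable {X : Type} [NormedAddCommGroup X] [NormedSpace ℝ X]

theorem integrable_exp_smul {s : ℝ} (hs : 0 < s) {u : ℝ → X} (hu : MemLp u 2 timeMeasure) :
    Integrable (fun t => Real.exp (-s * t) • u t) timeMeasure :=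
  memLp_one_iff_integrable.1 (hu.smul (memLp_exp_neg hs) (r := 1))

theorem ae_timeMeasure_pos : ∀ᵐ t ∂timeMeasure, 0 < t := by
  rw [show timeMeasure = volume.restrict (Ioi 0) from (restrict_Ioi_eq_restrict_Ici).symm]
  exact ae_restrict_mem measurableSet_Ioi

theorem tendsto_integral_exp_timeCutoff_smul {s : ℝ} (hs : 0 < s) {u : ℝ → X}
    (hu : MemLp u 2 timeMeasure) :
    Tendsto (fun k : ℕ => ∫ t, (Real.exp (-s * t) * timeCutoff k t) • u t ∂timeMeasure) atTop
      (𝓝 (∫ t, Real.exp (-s * t) • u t ∂timeMeasure)) := by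
  have hi := integrable_exp_smul hs hu
  refine tendsto_integral_of_dominated_convergence (fun t => ‖Real.exp (-s * t) • u t‖)
    (fun k => ?_) hi.norm (fun k => Eventually.of_forall fun t => ?_) ?_
  · have := continuous_timeCutoff (k : ℝ)
    exact (Continuous.aestronglyMeasurable (by fun_prop)).smul hu.1
  · rw [mul_comm, mul_smul, norm_smul, Real.norm_eq_abs]
    exact mul_le_of_le_one_left (norm_nonneg _) (abs_timeCutoff_le_one _ _)
  · filter_upwards [ae_timeMeasure_pos] with t ht
    simpa using ((tendsto_timeCutoff ht).const_mul (Real.exp (-s * t))).smul_const (u t)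

/-- At a fixed t the integrand vanishes once k > t, and the derivative of the cutoff is bounded, so
dominated convergence applies. -/
theorem tendsto_integral_exp_deriv_cutoff_smul {s : ℝ} (hs : 0 < s) {u : ℝ → X}
    (hu : MemLp u 2 timeMeasure) :
    Tendsto (fun k : ℕ => ∫ t, (Real.exp (-s * t) * (Real.smoothTransition (k * t - 1)
      * deriv Real.smoothTransition (t - k))) • u t ∂timeMeasure) atTop (𝓝 0) := by
  obtain ⟨B, hB⟩ := exists_abs_deriv_smoothTransition_le
  have hi := integrable_exp_smul hs hu
  rw [← integral_zero ℝ X (μ := timeMeasure)]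
  refine tendsto_integral_of_dominated_convergence (fun t => B * ‖Real.exp (-s * t) • u t‖)
    (fun k => ?_) (hi.norm.const_mul B) (fun k => Eventually.of_forall fun t => ?_) ?_
  · have h1 := Real.smoothTransition.continuous
    have h2 := continuous_deriv_smoothTransition
    exact (Continuous.aestronglyMeasurable (by fun_prop)).smul hu.1
  · rw [mul_comm, mul_smul, norm_smul, Real.norm_eq_abs]
    refine mul_le_mul_of_nonneg_right ?_ (norm_nonneg _)
    rw [abs_mul, abs_of_nonneg (Real.smoothTransition.nonneg _)]
    exact (mul_le_of_le_one_left (abs_nonneg _) (Real.smoothTransition.le_one _)).trans (hB _)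
  · refine Eventually.of_forall fun t => tendsto_const_nhds.congr' ?_
    filter_upwards [tendsto_natCast_atTop_atTop.eventually_gt_atTop t] with k hk
    rw [deriv_smoothTransition_eq_zero fun h => absurd h.1 (by linarith)]
    simp

theorem tendsto_integral_approx_dirac_smul [CompleteSpace X] {s : ℝ} (hs : 0 < s) {u : ℝ → X}
    (hu : ContinuousOn u (Ici 0)) :
    Tendsto (fun k : ℕ => ∫ t, ((k : ℝ) * (deriv Real.smoothTransition (k * t - 1) *
        (Real.exp (-s * t) * (1 - Real.smoothTransition (t - k))))) • u t ∂timeMeasure) atTop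
      (𝓝 (u 0)) := by
  obtain ⟨B, hB⟩ := exists_abs_deriv_smoothTransition_le
  have hB0 : 0 ≤ B := (abs_nonneg _).trans (hB 0)
  obtain ⟨M, hM⟩ := (isCompact_Icc (a := (0 : ℝ)) (b := 2)).exists_bound_of_continuousOn
    (hu.mono Icc_subset_Ici_self)
  have hM0 : 0 ≤ M := (norm_nonneg _).trans (hM 0 ⟨le_rfl, zero_le_two⟩)
  have hθ := Real.smoothTransition.continuous
  have hθ' := continuous_deriv_smoothTransition
  -- The integrand after the substitution r = kt. Its factor θ'(r - 1), with θ the smooth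
  -- transition, lives on [1, 2], where r/k ≤ 2 for k ≥ 1, so it is dominated by a constant there
  -- and tends to θ'(r - 1) u(0).
  let g : ℕ → ℝ → X := fun k r => (deriv Real.smoothTransition (r - 1) *
    (Real.exp (-s * (r / k)) * (1 - Real.smoothTransition (r / k - k)))) • u (r / k)
  have hlim : Tendsto (fun k => ∫ r in Ioi 0, g k r) atTop
      (𝓝 (∫ r in Ioi 0, deriv Real.smoothTransition (r - 1) • u 0)) := by
    refine tendsto_integral_filter_of_dominated_convergence
      ((Icc (1 : ℝ) 2).indicator fun _ => B * M) (Eventually.of_forall fun k => ?_) ?_ ?_ ?_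
    · refine ContinuousOn.aestronglyMeasurable ?_ measurableSet_Ioi
      have h1 : ContinuousOn (fun r : ℝ => u (r / k)) (Ioi 0) :=
        hu.comp (by fun_prop) fun r hr => mem_Ici.2 (div_nonneg (le_of_lt hr) (Nat.cast_nonneg k))
      exact ContinuousOn.smul (by fun_prop) h1
    · filter_upwards [eventually_ge_atTop 1] with k hk
      have hk' : (1 : ℝ) ≤ k := by exact_mod_cast hk
      filter_upwards [ae_restrict_mem measurableSet_Ioi] with r hr
      have hr0 : (0 : ℝ) < r := hr
      by_cases h : r ∈ Icc (1 : ℝ) 2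
      · rw [indicator_of_mem h, norm_smul, Real.norm_eq_abs, abs_mul, abs_mul,
          abs_of_pos (Real.exp_pos _)]
        have h1 : Real.exp (-s * (r / k)) ≤ 1 := by
          rw [Real.exp_le_one_iff, neg_mul, neg_nonpos]
          positivity
        have h2 : |1 - Real.smoothTransition (r / k - k)| ≤ 1 := by
          have h3 := Real.smoothTransition.nonneg (r / k - k)
          have h4 := Real.smoothTransition.le_one (r / k - k)
          rw [abs_le]
          constructor <;> linarith
        have h3 : ‖u (r / k)‖ ≤ M := hM _ ⟨by positivity,
          (div_le_self hr0.le hk').trans h.2⟩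
        refine mul_le_mul ?_ h3 (norm_nonneg _) hB0
        calc _ ≤ B * (1 * 1) := mul_le_mul (hB _)
              (mul_le_mul h1 h2 (abs_nonneg _) zero_le_one) (by positivity) hB0
          _ = B := by ring
      · rw [indicator_of_notMem h]
        simp only [g]
        rw [deriv_smoothTransition_eq_zero fun h' => h ⟨by linarith [h'.1], by linarith [h'.2]⟩]
        simp
    · exact (integrable_indicator_iff measurableSet_Icc).2
        (integrableOn_const (by simp) (by finiteness)) |>.integrableOn
    · filter_upwards [ae_restrict_mem measurableSet_Ioi] with r hr
      have hr0 : (0 : ℝ) < r := hr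
      have hrk : Tendsto (fun k : ℕ => r / (k : ℝ)) atTop (𝓝 0) :=
        tendsto_const_div_atTop_nhds_zero_nat r
      have h1 : Tendsto (fun k : ℕ => u (r / k)) atTop (𝓝 (u 0)) :=
        (hu 0 self_mem_Ici).tendsto.comp (tendsto_nhdsWithin_iff.2 ⟨hrk,
          Eventually.of_forall fun k => div_nonneg hr0.le (Nat.cast_nonneg k)⟩)
      have h2 : Tendsto (fun k : ℕ => Real.exp (-s * (r / k))) atTop (𝓝 1) := by
        have := (Real.continuous_exp.tendsto (-s * 0)).comp (hrk.const_mul (-s))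
        rwa [mul_zero, Real.exp_zero] at this
      have h3 : Tendsto (fun k : ℕ => 1 - Real.smoothTransition (r / k - k)) atTop (𝓝 1) := by
        refine tendsto_const_nhds.congr' ?_
        filter_upwards [tendsto_natCast_atTop_atTop.eventually_ge_atTop r,
          tendsto_natCast_atTop_atTop.eventually_ge_atTop (1 : ℝ)] with k hk1 hk2
        have : r / k ≤ r := div_le_self hr0.le hk2
        rw [Real.smoothTransition.zero_of_nonpos (by linarith), sub_zero]
      have h4 := ((h2.mul h3).const_mul (deriv Real.smoothTransition (r - 1))).smul h1
      rwa [mul_one, mul_one] at h4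
  rw [integral_smul_const, integral_deriv_smoothTransition_sub_one, one_smul] at hlim
  refine hlim.congr' ?_
  filter_upwards [eventually_ge_atTop 1] with k hk
  have hk' : (0 : ℝ) < k := by exact_mod_cast hk
  change _ = ∫ t in Ici 0, _
  rw [integral_Ici_eq_integral_Ioi]
  have h1 := integral_comp_mul_left_Ioi (g k) 0 hk'
  rw [mul_zero] at h1
  have h2 : ∫ r in Ioi 0, g k r = (k : ℝ) • ∫ t in Ioi 0, g k (k * t) := by
    rw [h1, smul_inv_smul₀ hk'.ne']
  rw [h2, ← integral_smul]
  refine integral_congr_ae (Eventually.of_forall fun t => ?_)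
  simp only [g]
  rw [mul_div_cancel_left₀ t hk'.ne', smul_smul]

theorem integrable_smul_of_hasCompactSupport {φ : ℝ → ℝ} (hc : Continuous φ)
    (hφ : HasCompactSupport φ) {u : ℝ → X} (hu : MemLp u 2 timeMeasure) :
    Integrable (fun t => φ t • u t) timeMeasure :=
  memLp_one_iff_integrable.1
    (hu.smul (hc.memLp_of_hasCompactSupport hφ : MemLp φ 2 timeMeasure) (r := 1))

/-- Laplace transform of a weak derivative. -/
theorem IsWeakTimeDeriv.integral_exp_smul [CompleteSpace X] {u w : ℝ → X} {a : X}
    (h : IsWeakTimeDeriv u w) (ha : HasInitialValue u a) (hu : MemLp u 2 timeMeasure)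
    (hw : MemLp w 2 timeMeasure) {s : ℝ} (hs : 0 < s) :
    ∫ t, Real.exp (-s * t) • w t ∂timeMeasure
      = s • (∫ t, Real.exp (-s * t) • u t ∂timeMeasure) - a := by
  obtain ⟨u', hc, hae, rfl⟩ := ha
  have hθ := Real.smoothTransition.continuous
  have hθ' := continuous_deriv_smoothTransition
  have h1 := tendsto_integral_exp_timeCutoff_smul hs hu
  have h2 := tendsto_integral_exp_timeCutoff_smul hs hw
  have h3 := tendsto_integral_exp_deriv_cutoff_smul hs hu
  have h4 := tendsto_integral_approx_dirac_smul hs hc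
  have h5 := (h1.const_smul s).sub (h4.sub h3)
  rw [sub_zero] at h5
  refine tendsto_nhds_unique (h2.congr' ?_) h5
  filter_upwards [eventually_ge_atTop 1] with k hk
  have hk' : (0 : ℝ) < k := by exact_mod_cast hk
  have hT := isTest_exp_mul_timeCutoff s hk'
  have e1 := h _ hT
  simp_rw [deriv_exp_mul_timeCutoff, add_smul, sub_smul, neg_smul] at e1
  have i1 := hT.integrable_smul hu
  have i2 : Integrable (fun t => ((k : ℝ) * (deriv Real.smoothTransition (k * t - 1) *
      (Real.exp (-s * t) * (1 - Real.smoothTransition (t - k))))) • u t) timeMeasure := by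
    refine integrable_smul_of_hasCompactSupport (by fun_prop)
      (HasCompactSupport.intro (isCompact_Icc (a := 1 / (k : ℝ)) (b := 2 / k)) fun t ht => ?_) hu
    rw [deriv_smoothTransition_eq_zero fun h => ht ⟨(div_le_iff₀' hk').2 (by linarith [h.1]),
      (le_div_iff₀' hk').2 (by linarith [h.2])⟩]
    simp
  have i3 : Integrable (fun t => (Real.exp (-s * t) * (Real.smoothTransition (k * t - 1)
      * deriv Real.smoothTransition (t - k))) • u t) timeMeasure := by
    refine integrable_smul_of_hasCompactSupport (by fun_prop)
      (HasCompactSupport.intro (isCompact_Icc (a := (k : ℝ)) (b := k + 1)) fun t ht => ?_) hu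
    rw [deriv_smoothTransition_eq_zero fun h => ht ⟨by linarith [h.1], by linarith [h.2]⟩]
    simp
  have i1' : Integrable (fun t => -((s * (Real.exp (-s * t) * timeCutoff k t)) • u t))
      timeMeasure := by
    simp_rw [mul_smul s]
    exact (i1.smul s).neg
  rw [integral_add i1' (Integrable.sub' i2 i3), integral_sub i2 i3, integral_neg] at e1
  simp_rw [mul_smul s] at e1
  rw [integral_smul] at e1
  -- The Dirac term is evaluated on the continuous representative, the one whose value at 0 is
  -- meaningful.
  have e2 : ∫ t, ((k : ℝ) * (deriv Real.smoothTransition (k * t - 1) *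
      (Real.exp (-s * t) * (1 - Real.smoothTransition (t - k))))) • u' t ∂timeMeasure
      = ∫ t, ((k : ℝ) * (deriv Real.smoothTransition (k * t - 1) *
      (Real.exp (-s * t) * (1 - Real.smoothTransition (t - k))))) • u t ∂timeMeasure :=
    integral_congr_ae (hae.mono fun t ht => by simp only [ht])
  rw [e2]
  have e3 := neg_eq_iff_eq_neg.2 e1
  rw [← e3]
  abel

/-- Injectivity of the Laplace transform. -/
theorem ae_eq_zero_of_integral_exp_smul [CompleteSpace X] {u : ℝ → X}
    (hu : MemLp u 2 timeMeasure)
    (h : ∀ s : ℝ, 0 < s → ∫ t, Real.exp (-s * t) • u t ∂timeMeasure = 0) :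
    u =ᵐ[timeMeasure] 0 := by
  have h0 : ∀ᵐ t ∂timeMeasure, t ∈ Ioi (0 : ℝ) → u t = 0 := by
    refine isOpen_Ioi.ae_eq_zero_of_integral_contDiff_smul_eq_zero
      ((hu.locallyIntegrable (by norm_num)).locallyIntegrableOn _) fun g hg hgc hgs => ?_
    have hgi : Integrable (fun t => g t • u t) timeMeasure :=
      integrable_smul_of_hasCompactSupport hg.continuous hgc hu
    -- In the variable x = exp(-t), g(t) = exp(-t) F(exp(-t)). As g has bounded support, F vanishes
    -- near 0; at 0 itself the convention 0⁻¹ = 0 gives the right value.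
    let F : ℝ → ℝ := fun x => x⁻¹ * g (-Real.log x)
    have hF : ContinuousOn F (Icc 0 1) := by
      intro x hx
      rcases hx.1.eq_or_lt with rfl | hx0
      · obtain ⟨R, hR⟩ := hgc.isCompact.isBounded.exists_norm_le
        have hev : F =ᶠ[𝓝[Icc 0 1] 0] fun _ => 0 := by
          have h1 : ∀ᶠ x in 𝓝[Icc 0 1] (0 : ℝ), x < Real.exp (-R) :=
            nhdsWithin_le_nhds (gt_mem_nhds (Real.exp_pos _))
          filter_upwards [h1, self_mem_nhdsWithin] with x h1 h2
          rcases h2.1.eq_or_lt with rfl | h3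
          · simp [F]
          · have h4 : Real.log x < -R := (Real.log_lt_iff_lt_exp h3).2 h1
            simp only [F]
            rw [image_eq_zero_of_notMem_tsupport (f := g), mul_zero]
            intro h5
            have := (le_abs_self _).trans (hR _ h5)
            linarith
        exact (continuousWithinAt_const (b := (0 : ℝ))).congr_of_eventuallyEq hev (by simp [F])
      · have h1 : ContinuousAt Real.log x := Real.continuousAt_log hx0.ne'
        exact ((continuousAt_inv₀ hx0.ne').mul
          (hg.continuous.continuousAt.comp h1.neg)).continuousWithinAt
    -- exp(-t) p(exp(-t)) is a combination of the exponentials with s = i + 1; the extra factor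
    -- exp(-t) keeps s positive for the constant term.
    have hp : ∀ p : Polynomial ℝ,
        Integrable (fun t => (Real.exp (-1 * t) * p.eval (Real.exp (-t))) • u t) timeMeasure ∧
        ∫ t, (Real.exp (-1 * t) * p.eval (Real.exp (-t))) • u t ∂timeMeasure = 0 := by
      intro p
      have e1 : ∀ t, (Real.exp (-1 * t) * p.eval (Real.exp (-t))) • u t
          = ∑ i ∈ Finset.range (p.natDegree + 1),
            p.coeff i • (Real.exp (-((i : ℝ) + 1) * t) • u t) := by
        intro t
        rw [Polynomial.eval_eq_sum_range, Finset.mul_sum, Finset.sum_smul]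
        refine Finset.sum_congr rfl fun i _ => ?_
        rw [smul_smul, ← Real.exp_nat_mul, mul_left_comm, ← Real.exp_add]
        congr 3
        ring
      have i1 : ∀ i : ℕ, Integrable (fun t => p.coeff i • (Real.exp (-((i : ℝ) + 1) * t) • u t))
          timeMeasure := fun i => (integrable_exp_smul (by positivity) hu).smul _
      simp_rw [e1]
      refine ⟨integrable_finsetSum _ fun i _ => i1 i, ?_⟩
      rw [integral_finsetSum _ fun i _ => i1 i]
      refine Finset.sum_eq_zero fun i _ => ?_
      rw [integral_smul, h _ (by positivity), smul_zero]
    have hu1 := (integrable_exp_smul one_pos hu).norm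
    rw [← norm_eq_zero]
    refine le_antisymm (le_of_forall_pos_le_add fun r hr => ?_) (norm_nonneg _)
    obtain ⟨e, he, heI⟩ : ∃ e : ℝ, 0 < e ∧
        e * ∫ t, ‖Real.exp (-1 * t) • u t‖ ∂timeMeasure ≤ r := by
      have hI : 0 ≤ ∫ t, ‖Real.exp (-1 * t) • u t‖ ∂timeMeasure :=
        integral_nonneg fun t => norm_nonneg _
      refine ⟨r / ((∫ t, ‖Real.exp (-1 * t) • u t‖ ∂timeMeasure) + 1), by positivity, ?_⟩
      rw [div_mul_eq_mul_div, div_le_iff₀ (by positivity)]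
      nlinarith
    obtain ⟨p, hpF⟩ := exists_polynomial_near_of_continuousOn 0 1 F hF e he
    obtain ⟨hpi, hp0⟩ := hp p
    rw [zero_add, ← sub_zero (∫ t, g t • u t ∂timeMeasure), ← hp0, ← integral_sub hgi hpi]
    refine le_trans (norm_integral_le_of_norm_le (hu1.const_mul e) ?_)
      ((integral_const_mul _ _).trans_le heI)
    filter_upwards [ae_timeMeasure_pos] with t ht
    have hFt : g t = Real.exp (-1 * t) * F (Real.exp (-t)) := by
      simp only [F]
      rw [Real.log_exp, neg_neg, neg_one_mul, mul_inv_cancel_left₀ (Real.exp_pos _).ne']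
    rw [← sub_smul, hFt, ← mul_sub, mul_comm, mul_smul, norm_smul]
    refine mul_le_mul_of_nonneg_right ?_ (norm_nonneg _)
    rw [Real.norm_eq_abs, abs_sub_comm]
    exact (hpF _ ⟨(Real.exp_pos _).le, Real.exp_le_one_iff.2 (by linarith)⟩).le
  filter_upwards [h0, ae_timeMeasure_pos] with t h1 h2 using h1 h2

end Laplace

/-! ### Uniqueness of the transformed equation. -/

section Laplace

variable {V H W : Type} [NormedAddCommGroup V] [InnerProductSpace ℝ V]
  [NormedAddCommGroup H] [InnerProductSpace ℝ H] [NormedAddCommGroup W] [InnerProductSpace ℝ W]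

/-- Subtracting, with d = y - z, leaves s²‖jd‖² + (a + bs)‖Gd‖² = 0: the initial data cancel and
both coefficients are positive, so joint injectivity of j and G suffices. -/
theorem eq_of_laplace_eq {j : V →L[ℝ] H} {G : V →L[ℝ] W} {a b : ℝ} (ha : 0 < a)
    (hb : 0 < b) (hjG : ∀ x, j x = 0 → G x = 0 → x = 0) {u₀ : V} {s : ℝ} (hs : 0 < s)
    {y z : V} {r : ℝ}
    (h : s * inner ℝ (j (s • y - u₀)) (j (y - z)) - r + a * inner ℝ (G y) (G (y - z))
        + b * inner ℝ (G (s • y - u₀)) (G (y - z))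
      = s * inner ℝ (j (s • z - u₀)) (j (y - z)) - r + a * inner ℝ (G z) (G (y - z))
        + b * inner ℝ (G (s • z - u₀)) (G (y - z))) : y = z := by
  obtain ⟨d, rfl⟩ : ∃ d, y = z + d := ⟨y - z, (add_sub_cancel _ _).symm⟩
  rw [add_sub_cancel_left] at h
  simp only [map_sub, map_smul, map_add, inner_sub_left, inner_add_left, smul_add,
    real_inner_smul_left, real_inner_self_eq_norm_sq] at h
  have h1 : s ^ 2 * ‖j d‖ ^ 2 + (a + b * s) * ‖G d‖ ^ 2 = 0 := by linear_combination h
  have h2 : 0 ≤ s ^ 2 * ‖j d‖ ^ 2 := by positivity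
  have h3 : 0 ≤ (a + b * s) * ‖G d‖ ^ 2 := by positivity
  have h4 : ‖j d‖ ^ 2 = 0 :=
    (mul_eq_zero.1 (le_antisymm (by linarith) h2)).resolve_left (by positivity)
  have h5 : ‖G d‖ ^ 2 = 0 :=
    (mul_eq_zero.1 (le_antisymm (by linarith) h3)).resolve_left (by positivity)
  rw [hjG d (norm_eq_zero.1 (pow_eq_zero_iff two_ne_zero |>.1 h4))
    (norm_eq_zero.1 (pow_eq_zero_iff two_ne_zero |>.1 h5)), add_zero]

theorem memLp_exp_smul_const {s : ℝ} (hs : 0 < s) (x : V) :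
    MemLp (fun t => Real.exp (-s * t) • x) 2 timeMeasure :=
  (ContinuousLinearMap.toSpanSingleton ℝ x).comp_memLp' (memLp_exp_neg hs)

end Laplace

/-! ### Weak formulation with values in the dual of V. -/

section Abstract

variable {V H W : Type} [NormedAddCommGroup V] [InnerProductSpace ℝ V] [CompleteSpace V]
  [NormedAddCommGroup H] [InnerProductSpace ℝ H] [CompleteSpace H]
  [NormedAddCommGroup W] [InnerProductSpace ℝ W] [CompleteSpace W]

theorem innerSL_comp_eq_innerSL_adjoint (j : V →L[ℝ] H) (g : H) :
    (innerSL ℝ g).comp j = innerSL ℝ (j.adjoint g) := by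
  ext v
  exact (j.adjoint_inner_left v g).symm

/-- Existence in the form dual to `V`, with the stiffness form `(G x, G y)`. -/
theorem exists_dual_weakSolution {j : V →L[ℝ] H} (hj : DenseRange j) (G : V →L[ℝ] W)
    {a b α : ℝ} (ha : 0 < a) (hb : 0 < b) (hα : 0 < α)
    (hG : ∀ x, α * ‖x‖ ^ 2 ≤ ‖G x‖ ^ 2) (u₀ : V) (u₁ : H) (f : L2Time H) :
    ∃ (u v : L2Time V) (w : L2Time (StrongDual ℝ V)), IsWeakTimeDeriv u v ∧
      IsWeakTimeDeriv (fun t => (innerSL ℝ (j (v t))).comp j) w ∧ HasInitialValue u u₀ ∧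
      HasInitialValue (fun t => j (v t)) u₁ ∧
      ∀ᵐ t ∂timeMeasure, ∀ x, w t x + a * inner ℝ (G (u t)) (G x) + b * inner ℝ (G (v t)) (G x)
        = inner ℝ (f t) (j x) := by
  obtain ⟨u, v, h1, h2, h3, h4⟩ := exists_weakSolution hj (massOp G) ha hb hα
    (fun x y => by rw [inner_massOp_left, inner_massOp_right])
    (fun x => by rw [inner_massOp_left, real_inner_self_eq_norm_sq]; exact hG x) u₀ u₁ f
  -- z is the Riesz representative of ∂ₜ²u; composing with `innerSL ℝ` carries it to the dual.
  obtain ⟨z, hz⟩ : ∃ z : L2Time V, z = j.adjoint.compLp f - b • (massOp G).compLp v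
    - a • (massOp G).compLp u := ⟨_, rfl⟩
  rw [← hz] at h4
  refine ⟨u, v, (innerSL ℝ (E := V)).compLp z, h1, ?_, h2, h3, ?_⟩
  · refine (h4.clm_comp (innerSL ℝ) ((massOp j).comp_memLp' (Lp.memLp v))
      (Lp.memLp z)).congr (Eventually.of_forall fun t => ?_) (EventuallyEq.symm ((innerSL ℝ).coeFn_compLp z))
    exact (innerSL_comp_eq_innerSL_adjoint j (j (v t))).symm
  · filter_upwards [(innerSL ℝ (E := V)).coeFn_compLp z, j.adjoint.coeFn_compLp f,
      (massOp G).coeFn_compLp v, (massOp G).coeFn_compLp u,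
      Lp.coeFn_sub (j.adjoint.compLp f - b • (massOp G).compLp v) (a • (massOp G).compLp u),
      Lp.coeFn_sub (j.adjoint.compLp f) (b • (massOp G).compLp v),
      Lp.coeFn_smul b ((massOp G).compLp v),
      Lp.coeFn_smul a ((massOp G).compLp u)] with t e1 e2 e3 e4 e5 e6 e7 e8 x
    rw [← hz, Pi.sub_apply, e6, Pi.sub_apply, e7, e8, Pi.smul_apply, Pi.smul_apply, e2, e3, e4]
      at e5
    rw [e1, innerSL_apply_apply, e5]
    simp only [inner_sub_left, real_inner_smul_left, inner_massOp_left,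
      ContinuousLinearMap.adjoint_inner_left]
    ring

/-- The Laplace transform of the left-hand side of the weak formulation, tested with
`exp (-s t) x`. -/
theorem integral_weakForm_exp_smul {j : V →L[ℝ] H} {G : V →L[ℝ] W} {a b : ℝ} {u₀ : V} {u₁ : H}
    {u v : L2Time V} {w : L2Time (StrongDual ℝ V)} (h1 : IsWeakTimeDeriv u v)
    (h2 : IsWeakTimeDeriv (fun t => (innerSL ℝ (j (v t))).comp j) w) (h3 : HasInitialValue u u₀)
    (h4 : HasInitialValue (fun t => j (v t)) u₁) {s : ℝ} (hs : 0 < s) (x : V) {z : ℝ → V}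
    (hz : z =ᵐ[timeMeasure] fun t => Real.exp (-s * t) • x) :
    ∫ t, (w t (z t) + a * inner ℝ (G (u t)) (G (z t)) + b * inner ℝ (G (v t)) (G (z t)))
        ∂timeMeasure
      = s * inner ℝ (j (s • (∫ t, Real.exp (-s * t) • u t ∂timeMeasure) - u₀)) (j x)
      - inner ℝ u₁ (j x)
      + a * inner ℝ (G (∫ t, Real.exp (-s * t) • u t ∂timeMeasure)) (G x)
      + b * inner ℝ (G (s • (∫ t, Real.exp (-s * t) • u t ∂timeMeasure) - u₀)) (G x) := by
  -- J embeds H in the dual of V and T = J ∘ j. Since J is continuous, it carries the initial value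
  -- u₁ of jv in H to an initial value of Tv in the dual, where the Laplace formula for w is
  -- applied.
  let T : V →L[ℝ] StrongDual ℝ V := (innerSL ℝ).comp (massOp j)
  let J : H →L[ℝ] StrongDual ℝ V := (innerSL ℝ).comp j.adjoint
  have hJ : ∀ g, J g = (innerSL ℝ g).comp j := fun g => (innerSL_comp_eq_innerSL_adjoint j g).symm
  have hT : ∀ y, T y = (innerSL ℝ (j y)).comp j := fun y => hJ (j y)
  let ℓ : StrongDual ℝ V →L[ℝ] ℝ := ContinuousLinearMap.apply ℝ ℝ x
  let γ : V →L[ℝ] ℝ := innerSL ℝ (massOp G x)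
  have hγ : ∀ y, γ y = inner ℝ (G y) (G x) := fun y => by
    simp only [γ]
    rw [innerSL_apply_apply, inner_massOp_left, real_inner_comm]
  have hu := Lp.memLp u
  have hv := Lp.memLp v
  have hw := Lp.memLp w
  simp_rw [← hT] at h2
  have l1 := h1.integral_exp_smul h3 hu hv hs
  have h4' : HasInitialValue (fun t => T (v t)) (J u₁) := h4.clm_comp J
  have l2 := h2.integral_exp_smul h4' (T.comp_memLp' hv) hw hs
  have l3 : ∫ t, Real.exp (-s * t) • T (v t) ∂timeMeasure
      = T (∫ t, Real.exp (-s * t) • v t ∂timeMeasure) := by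
    rw [← T.integral_comp_comm (integrable_exp_smul hs hv)]
    simp only [map_smul]
  rw [l3, l1] at l2
  have e1 : ∫ t, (w t (z t) + a * inner ℝ (G (u t)) (G (z t)) + b * inner ℝ (G (v t)) (G (z t)))
        ∂timeMeasure
      = ∫ t, (ℓ (Real.exp (-s * t) • w t) + a * γ (Real.exp (-s * t) • u t)
        + b * γ (Real.exp (-s * t) • v t)) ∂timeMeasure := by
    refine integral_congr_ae ?_
    filter_upwards [hz] with t ht
    rw [ht, hγ, hγ]
    simp only [map_smul, real_inner_smul_left, real_inner_smul_right, smul_eq_mul, ℓ,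
      ContinuousLinearMap.apply_apply]
  have i1 := ℓ.integrable_comp (integrable_exp_smul hs hw)
  have i2 := (γ.integrable_comp (integrable_exp_smul hs hu)).const_mul a
  have i3 := (γ.integrable_comp (integrable_exp_smul hs hv)).const_mul b
  rw [e1, integral_add (i1.fun_add i2) i3, integral_add i1 i2, integral_const_mul,
    integral_const_mul, ℓ.integral_comp_comm (integrable_exp_smul hs hw),
    γ.integral_comp_comm (integrable_exp_smul hs hu),
    γ.integral_comp_comm (integrable_exp_smul hs hv), l2, l1, hγ, hγ, hT, hJ]
  rfl

theorem eq_of_forall_integral_exp_smul_eq {u v : L2Time V}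
    (h : ∀ s : ℝ, 0 < s → ∫ t, Real.exp (-s * t) • u t ∂timeMeasure
      = ∫ t, Real.exp (-s * t) • v t ∂timeMeasure) : u = v := by
  refine Lp.ext ?_
  have h0 := ae_eq_zero_of_integral_exp_smul ((Lp.memLp u).sub (Lp.memLp v)) fun s hs => by
    simp_rw [Pi.sub_apply, smul_sub]
    rw [integral_sub (integrable_exp_smul hs (Lp.memLp u)) (integrable_exp_smul hs (Lp.memLp v)),
      h s hs, sub_self]
  filter_upwards [h0] with t ht
  exact sub_eq_zero.1 ht

end Abstract

/-! ### Application to H¹₀(Ω) and L²(Ω). -/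

section Main

variable {n : ℕ} {Ω : Set (E n)}

instance : CompleteSpace (H10 Ω) :=
  inferInstanceAs (CompleteSpace (testPairs Ω).topologicalClosure)

theorem exists_isWeakSolution (hn : 1 ≤ n) (hΩ_open : IsOpen Ω)
    (hΩ_bdd : Bornology.IsBounded Ω) {c ε ν : ℝ} (hc : 0 < c) (hε : 0 < ε) (hν : 0 < ν)
    (f : L2Time (L2 Ω)) (u₀ : H10 Ω) (u₁ : L2 Ω) :
    ∃ u : L2Time (H10 Ω), IsWeakSolution Ω c ε ν f u₀ u₁ u := by
  obtain ⟨C, hC, hP⟩ := exists_norm_toL2_sq_le hn hΩ_bdd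
  -- Poincaré gives ‖x‖² ≤ (C + 1)‖∇x‖² for the full H¹ norm, hence α = 1/(C + 1).
  obtain ⟨u, v, w, h1, h2, h3, h4, h5⟩ := exists_dual_weakSolution (denseRange_toL2 hΩ_open)
    (grad Ω) (a := c ^ 2) (b := ε * ν) (α := 1 / (C + 1)) (by positivity)
    (by positivity) (by positivity) (fun x => by
      rw [norm_sq_eq_toL2_add_grad, div_mul_eq_mul_div, div_le_iff₀ (by positivity)]
      linarith [hP x]) u₀ u₁ f
  exact ⟨u, v, w, h1, h2, h3, h4, fun z => integral_congr_ae (h5.mono fun t ht => ht (z t))⟩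

theorem IsWeakSolution.eq {c ε ν : ℝ} (hc : 0 < c) (hε : 0 < ε) (hν : 0 < ν)
    {f : L2Time (L2 Ω)} {u₀ : H10 Ω} {u₁ : L2 Ω} {u v : L2Time (H10 Ω)}
    (hu : IsWeakSolution Ω c ε ν f u₀ u₁ u) (hv : IsWeakSolution Ω c ε ν f u₀ u₁ v) :
    u = v := by
  obtain ⟨ut, utt, h1, h2, h3, h4, h5⟩ := hu
  obtain ⟨vt, vtt, k1, k2, k3, k4, k5⟩ := hv
  refine eq_of_forall_integral_exp_smul_eq fun s hs => ?_
  -- Both weak formulations are tested with exp(-st) x, x being the difference of the two transforms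
  -- at s; r is the contribution of u₁, common to both.
  refine eq_of_laplace_eq (j := toL2 Ω) (G := grad Ω) (a := c ^ 2) (b := ε * ν)
    (by positivity) (by positivity) (fun x hx hx' => ?_) (u₀ := u₀) hs (r := inner ℝ u₁ (toL2 Ω
      ((∫ t, Real.exp (-s * t) • u t ∂timeMeasure) - ∫ t, Real.exp (-s * t) • v t ∂timeMeasure))) ?_
  · have h := norm_sq_eq_toL2_add_grad x
    rw [hx, hx', norm_zero, norm_zero] at h
    exact norm_eq_zero.1 (pow_eq_zero_iff two_ne_zero |>.1 (by linarith))
  · have hx := memLp_exp_smul_const hs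
      ((∫ t, Real.exp (-s * t) • u t ∂timeMeasure) - ∫ t, Real.exp (-s * t) • v t ∂timeMeasure)
    exact (integral_weakForm_exp_smul h1 h2 h3 h4 hs _ hx.coeFn_toLp).symm.trans
      (((h5 _).trans (k5 _).symm).trans
        (integral_weakForm_exp_smul k1 k2 k3 k4 hs _ hx.coeFn_toLp))

end Main

end DampedWave

end

theorem mainTheorem5 (n : ℕ) (hn : 1 ≤ n) (Ω : Set (EuclideanSpace ℝ (Fin n)))
    (hΩ_open : IsOpen Ω) (hΩ_conn : IsConnected Ω) (hΩ_bdd : Bornology.IsBounded Ω)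
    (c ε ν : ℝ) (hc : 0 < c) (hε : 0 < ε) (hν : 0 < ν)
    (f : DampedWave.L2Time (DampedWave.L2 Ω)) (u₀ : DampedWave.H10 Ω) (u₁ : DampedWave.L2 Ω) :
    ∃! u : DampedWave.L2Time (DampedWave.H10 Ω),
      DampedWave.IsWeakSolution Ω c ε ν f u₀ u₁ u := by
  obtain ⟨u, hu⟩ := DampedWave.exists_isWeakSolution hn hΩ_open hΩ_bdd hc hε hν f u₀ u₁
  exact ⟨u, hu, fun v hv => hv.eq hc hε hν hu⟩
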